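/- Let $p\ge 0$ be real, $\theta\in\{e,o\}$, $j\ge 0$ an integer, $c\ne 0$ real, and $r\in\{1,2,\dots\}\cup\{\infty\}$. Define $$\Lambda_p^e(z)=\frac1{\sqrt{2\pi}}\sum_{n\ge0}(-1)^n\frac{z^{2n}}{(2n)!}\prod_{k=0}^{n-1}(p+2k+1),\qquad \Lambda_p^o(z)=\frac1{\sqrt{2\pi}}\sum_{n\ge0}(-1)^n\frac{z^{2n+1}}{(2n+1)!}\prod_{k=0}^{n}(p+2k).$$ Let $f:\mathbb R\to\mathbb R$ satisfy: for every integer $k\geq 0$ with $k\le r$ there is an integer $m>p+1+j+k$ such that $f$ is $m$ times continuously differentiable and $f,f',\dots,f^{(m)}$ are absolutely integrable on $\mathbb R$. (For finite $r$ it suffices that this holds for $k=r$.) For $\rho>0$ put $$\phi_p^\theta(x,\rho)=\int_{-\infty}^{\infty} f(x-\nu)\,\rho^{p+1}\Lambda_p^\theta(\nu\rho)\,d\nu ,$$ and let $\Psi_p^\theta:\mathbb R^2\to\mathbb R$ be given by $\Psi_p^\theta(x,\sigma)=\phi_p^\theta(x,1/|\sigma|)$ for $\sigma\neq0$ and $\Psi_p^\theta(x,0)=\lim_{\rho\to\infty}\phi_p^\theta(x,\rho)$.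 **Theorem 3.1.** Assume the generic condition that there is no point $(x,\sigma)\in\mathbb R^2$ with $$\frac{\partial^{j+1}\Psi_p^\theta}{\partial x^j\,\partial\sigma}(x,\sigma)=\frac{\partial^{j+1}\Psi_p^\theta}{\partial x^{j+1}}(x,\sigma)=0\quad\text{and}\quad \frac{\partial^{j}\Psi_p^\theta}{\partial x^{j}}(x,\sigma)=c .$$ Then the level set $$M_c^{jp}=\Big\{(x,\sigma)\in\mathbb R^2:\ \frac{\partial^{j}\Psi_p^\theta}{\partial x^{j}}(x,\sigma)=c\Big\}$$ is a finite (possibly empty) union of pairwise disjoint simple closed regular curves of class $C^r$, each of which is symmetric with respect to the $x$-axis $\{\sigma=0\}$. Here a simple closed regular curve of class $C^r$ is the image of a periodic $C^r$ map $\gamma:\mathbb R\to\mathbb R^2$ with some period $T>0$, with $\gamma'(t)\neq0$ for all $t$, that is injective on $[0,T)$. -/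

import Mathlib

open Filter MeasureTheory
open scoped Topology Nat

namespace ScaleSpace

/-- The two families of kernels: `even` stands for `θ = e`, `odd` for `θ = o`. -/
inductive Parity
  | even
  | odd

/-- `Λ_p^e(z) = (2π)^{-1/2} ∑ₙ (-1)ⁿ z^{2n}/(2n)! ∏_{k=0}^{n-1} (p+2k+1)`. -/
noncomputable def kernelEven (p z : ℝ) : ℝ :=
  1 / √(2 * Real.pi) *
    ∑' n : ℕ, z ^ (2 * n) / ((2 * n)! : ℝ) * (-1) ^ n *
      ∏ k ∈ Finset.range n, (p + 2 * (k : ℝ) + 1)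

/-- `Λ_p^o(z) = (2π)^{-1/2} ∑ₙ (-1)ⁿ z^{2n+1}/(2n+1)! ∏_{k=0}^{n} (p+2k)`. -/
noncomputable def kernelOdd (p z : ℝ) : ℝ :=
  1 / √(2 * Real.pi) *
    ∑' n : ℕ, z ^ (2 * n + 1) / ((2 * n + 1)! : ℝ) * (-1) ^ n *
      ∏ k ∈ Finset.range (n + 1), (p + 2 * (k : ℝ))

/-- The kernel `Λ_p^θ`. -/
noncomputable def kernel : Parity → ℝ → ℝ → ℝ
  | Parity.even => kernelEven
  | Parity.odd => kernelOdd

/-- The convolution `φ_p^θ(x, ρ) = ∫ f(x - ν) ρ^{p+1} Λ_p^θ(ν ρ) dν`, for `ρ > 0`. -/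
noncomputable def phi (f : ℝ → ℝ) (θ : Parity) (p x ρ : ℝ) : ℝ :=
  ∫ ν : ℝ, f (x - ν) * (ρ ^ (p + 1) * kernel θ p (ν * ρ))

open Classical in
/-- The scale-space function `Ψ_p^θ(x, σ)` on the whole plane: `φ_p^θ(x, 1/|σ|)` for `σ ≠ 0`, and
the limit of `φ_p^θ(x, ρ)` as `ρ → ∞` for `σ = 0`. -/
noncomputable def Psi (f : ℝ → ℝ) (θ : Parity) (p x σ : ℝ) : ℝ :=
  if σ = 0 then limUnder atTop (fun ρ : ℝ => phi f θ p x ρ) else phi f θ p x (1 / |σ|)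

/-- The mixed partial derivative `∂^{k+n} u / ∂x^k ∂σ^n` at `(x, σ)`. -/
noncomputable def mixedPartial (k n : ℕ) (u : ℝ → ℝ → ℝ) (x σ : ℝ) : ℝ :=
  iteratedDeriv n (fun s => iteratedDeriv k (fun y => u y s) x) σ

/-- The signal is `m` times continuously differentiable and its derivatives of all orders
`0, …, m` are absolutely integrable on the line. -/
def IsSignal (m : ℕ) (f : ℝ → ℝ) : Prop :=
  ContDiff ℝ m f ∧ ∀ i ≤ m, Integrable (iteratedDeriv i f)

/-- The level set `{(x, σ) : ∂^j Ψ_p^θ / ∂x^j = c}`. -/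
def levelSet (f : ℝ → ℝ) (θ : Parity) (p : ℝ) (j : ℕ) (c : ℝ) : Set (ℝ × ℝ) :=
  {z | mixedPartial j 0 (Psi f θ p) z.1 z.2 = c}

/-- The genericity condition: the level `c` of `∂^j Ψ_p^θ / ∂x^j` contains no point at which
both first order partial derivatives of `∂^j Ψ_p^θ / ∂x^j` vanish. -/
def IsGeneric (f : ℝ → ℝ) (θ : Parity) (p : ℝ) (j : ℕ) (c : ℝ) : Prop :=
  ¬ ∃ x σ : ℝ, mixedPartial j 1 (Psi f θ p) x σ = 0 ∧
    mixedPartial (j + 1) 0 (Psi f θ p) x σ = 0 ∧ mixedPartial j 0 (Psi f θ p) x σ = c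

/-- `K` is a simple closed regular curve of class `C^r` in the plane (an embedded circle): the
image of a `C^r` map of the line of some period `T > 0`, with nowhere vanishing velocity, that is
injective on a period. -/
def IsClosedCurve (r : ℕ∞) (K : Set (ℝ × ℝ)) : Prop :=
  ∃ (T : ℝ) (γ : ℝ → ℝ × ℝ), 0 < T ∧ ContDiff ℝ r γ ∧ Function.Periodic γ T ∧
    (∀ t, deriv γ t ≠ 0) ∧ Set.InjOn γ (Set.Ico 0 T) ∧ Set.range γ = K

/-- `K` is symmetric with respect to the `x`-axis. -/
def IsSymmetric (K : Set (ℝ × ℝ)) : Prop :=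
  ∀ x σ : ℝ, (x, σ) ∈ K ↔ (x, -σ) ∈ K

end ScaleSpace

namespace ScaleSpace

open scoped FourierTransform

/-! Expanding the kernels as Gaussian moment series shows that `Psi` is the real part of a
superposition of heat waves exp(iωx - (ωσ)²/2), ω > 0, whose spectrum is a constant times ω^p times
the Fourier transform of `f` (`phi_eq`, `Psi_eq`). Differentiation in x multiplies the spectrum by
iω, so F = ∂^jΨ/∂x^j has the same form. The factor exp(-(ωσ)²/2) is itself the Fourier transform of
a Gaussian of standard deviation |ω|, so a heat superposition is the Fourier transform of an
integrable density on the plane. Moments of the spectrum then give F the class C^r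
(`contDiff_heatTransform`), and the Riemann–Lebesgue lemma gives F → 0 at infinity
(`tendsto_heatTransform_cocompact`). Since c ≠ 0, the level set is compact; genericity says that c
is a regular value.

A compact regular level set is a finite disjoint union of closed orbits of the Hamiltonian field
(`exists_closed_trajectories`, `IsTrajectoryOn.exists_period`). For r = 1 this field is merely
continuous, so uniqueness comes not from a Lipschitz bound but from the level set being a curve, on
which the equation is scalar and solved by quadrature (`exists_flowBox`).

F is even in σ, so reflection permutes the orbits, and an orbit meeting the axis is its own mirror
image. That every orbit meets the axis follows from the heat equation F_σ = σF_xx: formally F dx +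
σF_x dσ is closed, and subtracting cx from its potential gives a function P with derivative σF_x²
along orbits in {F = c}. On a closed orbit in an open half plane P would be monotone and periodic,
hence constant, so F_x = 0 there; the motion would be horizontal with nonzero velocity, impossible
for a periodic x (`IsTrajectoryOn.exists_snd_eq_zero`). -/

/-! ### Flow boxes of the Hamiltonian field on a regular level -/

/-- The Hamiltonian vector field `(-∂F/∂σ, ∂F/∂x)` of a function on the plane. -/
noncomputable def hamiltonianField (F : ℝ × ℝ → ℝ) (z : ℝ × ℝ) : ℝ × ℝ :=
  (-(fderiv ℝ F z (0, 1)), fderiv ℝ F z (1, 0))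

lemma fderiv_apply_eq (F : ℝ × ℝ → ℝ) (z v : ℝ × ℝ) :
    fderiv ℝ F z v = v.1 * fderiv ℝ F z (1, 0) + v.2 * fderiv ℝ F z (0, 1) := by
  have h : v = v.1 • ((1 : ℝ), (0 : ℝ)) + v.2 • ((0 : ℝ), (1 : ℝ)) := by ext <;> simp
  conv_lhs => rw [h, map_add, map_smul, map_smul]
  simp

lemma continuous_hamiltonianField {F : ℝ × ℝ → ℝ} (hF : ContDiff ℝ 1 F) :
    Continuous (hamiltonianField F) := by
  have h := hF.continuous_fderiv one_ne_zero
  unfold hamiltonianField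
  fun_prop

lemma hamiltonianField_ne_zero {F : ℝ × ℝ → ℝ} {z : ℝ × ℝ} (h : fderiv ℝ F z ≠ 0) :
    hamiltonianField F z ≠ 0 := by
  contrapose! h
  have h1 := congrArg Prod.fst h
  have h2 := congrArg Prod.snd h
  simp only [hamiltonianField, Prod.fst_zero, Prod.snd_zero, neg_eq_zero] at h1 h2
  ext <;> simp [h1, h2]

/-- The linear functional `v ↦ ⟨a, v⟩` on the plane. -/
noncomputable def planeDot (a : ℝ × ℝ) : ℝ × ℝ →L[ℝ] ℝ :=
  a.1 • ContinuousLinearMap.fst ℝ ℝ ℝ + a.2 • ContinuousLinearMap.snd ℝ ℝ ℝ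

lemma planeDot_apply (a v : ℝ × ℝ) : planeDot a v = a.1 * v.1 + a.2 * v.2 := by
  simp [planeDot]

lemma planeDot_self_pos {a : ℝ × ℝ} (ha : a ≠ 0) : 0 < planeDot a a := by
  rw [planeDot_apply]
  by_contra! h
  apply ha
  ext
  · show a.1 = 0
    nlinarith [mul_self_nonneg a.1, mul_self_nonneg a.2]
  · show a.2 = 0
    nlinarith [mul_self_nonneg a.1, mul_self_nonneg a.2]

/-- Near a regular point a level set is parametrised by a linear coordinate. -/
lemma exists_local_section {F : ℝ × ℝ → ℝ} {c : ℝ} (hF : ContDiff ℝ 1 F) {z₀ : ℝ × ℝ}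
    (hz : F z₀ = c) (hreg : fderiv ℝ F z₀ ≠ 0) :
    ∃ (ℓ : ℝ × ℝ →L[ℝ] ℝ) (β : ℝ → ℝ × ℝ), β (ℓ z₀) = z₀ ∧
      (∀ᶠ s in 𝓝 (ℓ z₀), HasDerivAt β
          ((ℓ (hamiltonianField F (β s)))⁻¹ • hamiltonianField F (β s)) s ∧
        F (β s) = c ∧ ℓ (β s) = s ∧ 0 < ℓ (hamiltonianField F (β s))) ∧
      ∀ᶠ w in 𝓝 z₀, F w = c → β (ℓ w) = w := by
  have hX0 := hamiltonianField_ne_zero hreg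
  set X₀ := hamiltonianField F z₀ with hX₀
  set ℓ := planeDot X₀ with hℓ
  have hpos : 0 < ℓ X₀ := planeDot_self_pos hX0
  -- The kernel of the differential is spanned by `X₀`, on which `ℓ` is positive, so the pair is
  -- injective; up to sign its determinant is |X₀|².
  let A : ℝ × ℝ →L[ℝ] ℝ × ℝ := (fderiv ℝ F z₀).prod ℓ
  have hinj : Function.Injective A := by
    rw [injective_iff_map_eq_zero]
    intro v hv
    have h1 : fderiv ℝ F z₀ v = 0 := congrArg Prod.fst hv
    have h2 : ℓ v = 0 := congrArg Prod.snd hv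
    rw [fderiv_apply_eq] at h1
    rw [hℓ, planeDot_apply] at h2
    rw [hℓ, planeDot_apply] at hpos
    have e1 : X₀.1 = -(fderiv ℝ F z₀ (0, 1)) := rfl
    have e2 : X₀.2 = fderiv ℝ F z₀ (1, 0) := rfl
    rw [← e2, show fderiv ℝ F z₀ (0, 1) = -X₀.1 by rw [e1, neg_neg]] at h1
    ext
    · refine (mul_eq_zero.1 (?_ : (X₀.1 * X₀.1 + X₀.2 * X₀.2) * v.1 = 0)).resolve_left hpos.ne'
      linear_combination X₀.1 * h2 + X₀.2 * h1
    · refine (mul_eq_zero.1 (?_ : (X₀.1 * X₀.1 + X₀.2 * X₀.2) * v.2 = 0)).resolve_left hpos.ne'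
      linear_combination X₀.2 * h2 - X₀.1 * h1
  let A' : (ℝ × ℝ) ≃L[ℝ] (ℝ × ℝ) :=
    (LinearEquiv.ofInjectiveEndo (A : ℝ × ℝ →ₗ[ℝ] ℝ × ℝ) hinj).toContinuousLinearEquiv
  have hA' : (A' : ℝ × ℝ →L[ℝ] ℝ × ℝ) = A := by ext <;> rfl
  let Φ : ℝ × ℝ → ℝ × ℝ := fun z => (F z, ℓ z)
  have hΦ : ContDiff ℝ 1 Φ := hF.prodMk ℓ.contDiff
  have hΦ' : HasStrictFDerivAt Φ (A' : ℝ × ℝ →L[ℝ] ℝ × ℝ) z₀ := by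
    rw [hA']
    exact (hF.contDiffAt.hasStrictFDerivAt one_ne_zero).prodMk ℓ.hasStrictFDerivAt
  have hcd := (hΦ.contDiffAt (x := z₀)).to_localInverse hΦ'.hasFDerivAt one_ne_zero
  set Ψ := (hΦ.contDiffAt (x := z₀)).localInverse hΦ'.hasFDerivAt one_ne_zero with hΨ
  have hright : ∀ᶠ y in 𝓝 (Φ z₀), Φ (Ψ y) = y := HasStrictFDerivAt.eventually_right_inverse _
  have hleft : ∀ᶠ w in 𝓝 z₀, Ψ (Φ w) = w := HasStrictFDerivAt.eventually_left_inverse _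
  have hz0 : Φ z₀ = (c, ℓ z₀) := by simp [Φ, hz]
  have hβ0 : Ψ (c, ℓ z₀) = z₀ := by rw [← hz0]; exact hleft.self_of_nhds
  have htend : Tendsto (fun s : ℝ => (c, s)) (𝓝 (ℓ z₀)) (𝓝 (Φ z₀)) := by
    rw [hz0]; exact (by fun_prop : Continuous fun s : ℝ => (c, s)).tendsto _
  have hdiff : ∀ᶠ y in 𝓝 (Φ z₀), ContDiffAt ℝ 1 Ψ y := hcd.eventually (by simp)
  refine ⟨ℓ, fun s => Ψ (c, s), hβ0, ?_, ?_⟩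
  · have hβc : Tendsto (fun s : ℝ => Ψ (c, s)) (𝓝 (ℓ z₀)) (𝓝 z₀) := by
      have := hcd.continuousAt.tendsto.comp htend
      rwa [hz0, hβ0] at this
    have hposev : ∀ᶠ s in 𝓝 (ℓ z₀), 0 < ℓ (hamiltonianField F (Ψ (c, s))) := by
      have : Tendsto (fun s => ℓ (hamiltonianField F (Ψ (c, s)))) (𝓝 (ℓ z₀)) (𝓝 (ℓ X₀)) :=
        (ℓ.continuous.comp (continuous_hamiltonianField hF)).continuousAt.tendsto.comp hβc
      exact this.eventually (lt_mem_nhds hpos)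
    have hr := htend.eventually hright
    filter_upwards [hr.eventually_nhds, htend.eventually hdiff, hposev] with s hs hd hp
    have hs0 := hs.self_of_nhds
    have e1 : F (Ψ (c, s)) = c := congrArg Prod.fst hs0
    have e2 : ℓ (Ψ (c, s)) = s := congrArg Prod.snd hs0
    refine ⟨?_, e1, e2, hp⟩
    have hd1 : DifferentiableAt ℝ (fun s : ℝ => Ψ (c, s)) s :=
      (hd.differentiableAt one_ne_zero).comp s (by fun_prop)
    have hd2 := hd1.hasDerivAt
    set v := deriv (fun s : ℝ => Ψ (c, s)) s
    have k1 : fderiv ℝ F (Ψ (c, s)) v = 0 := by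
      have a1 := ((hF.differentiable one_ne_zero _).hasFDerivAt (x := Ψ (c, s))).comp_hasDerivAt s hd2
      have a2 : HasDerivAt (F ∘ fun s : ℝ => Ψ (c, s)) 0 s :=
        (hasDerivAt_const s c).congr_of_eventuallyEq
          (hs.mono fun t ht => congrArg Prod.fst ht)
      exact a1.unique a2
    have k2 : ℓ v = 1 := by
      have a1 := (ℓ.hasFDerivAt (x := Ψ (c, s))).comp_hasDerivAt s hd2
      have a2 : HasDerivAt (ℓ ∘ fun s : ℝ => Ψ (c, s)) 1 s :=
        (hasDerivAt_id s).congr_of_eventuallyEq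
          (hs.mono fun t ht => congrArg Prod.snd ht)
      exact a1.unique a2
    -- The tangent `v` is killed by the differential of `F`, hence is a multiple of the field, and
    -- `ℓ v = 1` fixes the multiple.
    have hv : v = (ℓ (hamiltonianField F (Ψ (c, s))))⁻¹ • hamiltonianField F (Ψ (c, s)) := by
      rw [eq_inv_smul_iff₀ hp.ne']
      rw [fderiv_apply_eq] at k1
      rw [hℓ, planeDot_apply] at k2 ⊢
      simp only [hamiltonianField]
      ext
      · simp only [Prod.smul_fst, smul_eq_mul]
        linear_combination (-(fderiv ℝ F (Ψ (c, s)) (0, 1))) * k2 + X₀.2 * k1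
      · simp only [Prod.smul_snd, smul_eq_mul]
        linear_combination (fderiv ℝ F (Ψ (c, s)) (1, 0)) * k2 - X₀.1 * k1
    rw [← hv]
    exact hd2
  · filter_upwards [hleft] with w hw hwc
    simpa [Φ, hwc] using hw

/-- A flow box of the Hamiltonian field on a level set, around a regular point. -/
lemma exists_flowBox {F : ℝ × ℝ → ℝ} {c : ℝ} (hF : ContDiff ℝ 1 F) {z₀ : ℝ × ℝ}
    (hz : F z₀ = c) (hreg : fderiv ℝ F z₀ ≠ 0) :
    ∃ (δ : ℝ) (α : ℝ → ℝ × ℝ) (T : ℝ × ℝ → ℝ), 0 < δ ∧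
      (∀ t ∈ Set.Ioo (-δ) δ, HasDerivAt α (hamiltonianField F (α t)) t ∧ F (α t) = c) ∧
      ∀ᶠ w in 𝓝 z₀, F w = c → |T w| < δ / 2 ∧ α (T w) = w ∧
        ∀ (γ : ℝ → ℝ × ℝ) (t : ℝ), γ t = w → HasDerivAt γ (hamiltonianField F w) t →
          HasDerivAt (fun s => T (γ s)) 1 t := by
  obtain ⟨ℓ, β, hβ0, hβ, hloc⟩ := exists_local_section hF hz hreg
  set s₀ := ℓ z₀ with hs₀
  obtain ⟨η, hη, hball⟩ := Metric.eventually_nhds_iff_ball.1 hβ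
  -- `q` is dt/ds, the time per unit of the coordinate s = ℓ. Its integral `τ` is elapsed time, and
  -- the inverse `θ` of `τ` turns `β` into a trajectory.
  set q : ℝ → ℝ := fun s => (ℓ (hamiltonianField F (β s)))⁻¹ with hq
  have hle : s₀ - η / 2 ≤ s₀ + η / 2 := by linarith
  have hmem : ∀ s ∈ Set.Icc (s₀ - η / 2) (s₀ + η / 2), s ∈ Metric.ball s₀ η := by
    intro s hs
    rw [Metric.mem_ball, Real.dist_eq, abs_lt]
    constructor <;> linarith [hs.1, hs.2]
  have hqc : ContinuousOn q (Set.Icc (s₀ - η / 2) (s₀ + η / 2)) := by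
    intro s hs
    obtain ⟨h1, -, -, h4⟩ := hball s (hmem s hs)
    have : ContinuousAt (fun s => ℓ (hamiltonianField F (β s))) s :=
      (ℓ.continuous.comp (continuous_hamiltonianField hF)).continuousAt.comp h1.continuousAt
    exact (this.inv₀ h4.ne').continuousWithinAt
  -- Extension by constants makes the integrand continuous on the whole line, so that `τ` is
  -- differentiable everywhere.
  set h : ℝ → ℝ := Set.IccExtend hle ((Set.Icc (s₀ - η / 2) (s₀ + η / 2)).domRestrict q) with hh
  have hcont : Continuous h := (continuousOn_iff_continuous_domRestrict.1 hqc).Icc_extend'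
  have heq : ∀ s ∈ Set.Icc (s₀ - η / 2) (s₀ + η / 2), h s = q s := fun s hs =>
    Set.IccExtend_of_mem hle _ hs
  have hqpos : ∀ s ∈ Set.Icc (s₀ - η / 2) (s₀ + η / 2), 0 < q s := fun s hs =>
    inv_pos.2 (hball s (hmem s hs)).2.2.2
  set τ : ℝ → ℝ := fun s => ∫ u in s₀..s, h u with hτ
  have hτd : ∀ s, HasStrictDerivAt τ (h s) s := fun s =>
    hcont.integral_hasStrictDerivAt s₀ s
  have hτ0 : τ s₀ = 0 := by simp [hτ]
  have hs₀mem : s₀ ∈ Set.Icc (s₀ - η / 2) (s₀ + η / 2) := ⟨by linarith, by linarith⟩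
  have hh0 : h s₀ ≠ 0 := by rw [heq s₀ hs₀mem]; exact (hqpos s₀ hs₀mem).ne'
  set θ := (hτd s₀).localInverse τ (h s₀) s₀ hh0 with hθ
  have hθd : HasStrictDerivAt θ (h s₀)⁻¹ 0 := by
    have := (hτd s₀).to_localInverse hh0
    rwa [hτ0] at this
  have hE := (hτd s₀).hasStrictFDerivAt_equiv hh0
  have hθr : ∀ᶠ t in 𝓝 (0 : ℝ), τ (θ t) = t := by
    have := hE.eventually_right_inverse
    rwa [hτ0] at this
  have hθl : ∀ᶠ s in 𝓝 s₀, θ (τ s) = s := hE.eventually_left_inverse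
  have hθ0 : θ 0 = s₀ := by rw [← hτ0]; exact hθl.self_of_nhds
  have hθcont : ∀ᶠ t in 𝓝 (0 : ℝ), ContinuousAt θ t := by
    have h2 : ContDiffAt ℝ 1 τ s₀ := by
      have : ContDiff ℝ 1 τ := by
        rw [contDiff_one_iff_deriv]
        refine ⟨fun s => (hτd s).hasDerivAt.differentiableAt, ?_⟩
        have : deriv τ = h := funext fun s => (hτd s).hasDerivAt.deriv
        rwa [this]
      exact this.contDiffAt
    have h3 := h2.to_localInverse hE.hasFDerivAt one_ne_zero
    have h4 : ContDiffAt ℝ 1 θ (τ s₀) := h3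
    rw [hτ0] at h4
    exact (h4.eventually (by simp)).mono fun t ht => ht.continuousAt
  have hIoo : Set.Ioo (s₀ - η / 2) (s₀ + η / 2) ∈ 𝓝 s₀ :=
    Ioo_mem_nhds (by linarith) (by linarith)
  have hθmem : ∀ᶠ t in 𝓝 (0 : ℝ), θ t ∈ Set.Ioo (s₀ - η / 2) (s₀ + η / 2) :=
    hθd.hasDerivAt.continuousAt.eventually (by rw [hθ0]; exact hIoo)
  obtain ⟨δ, hδ, hδball⟩ := Metric.eventually_nhds_iff_ball.1
    (hθr.eventually_nhds.and (hθcont.and hθmem))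
  refine ⟨δ, fun t => β (θ t), fun w => τ (ℓ w), hδ, ?_, ?_⟩
  · intro t ht
    have htb : t ∈ Metric.ball (0 : ℝ) δ := by
      rw [Metric.mem_ball, Real.dist_eq, sub_zero, abs_lt]; exact ht
    obtain ⟨k1, k2, k3⟩ := hδball t htb
    have k3' := Set.Ioo_subset_Icc_self k3
    obtain ⟨b1, b2, b3, b4⟩ := hball _ (hmem _ k3')
    refine ⟨?_, b2⟩
    have hne : h (θ t) ≠ 0 := by rw [heq _ k3']; exact (hqpos _ k3').ne'
    have hd : HasDerivAt θ (h (θ t))⁻¹ t :=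
      HasDerivAt.of_local_left_inverse k2 (hτd _).hasDerivAt hne k1
    have := b1.scomp t hd
    rw [heq _ k3'] at this
    simp only [hq, inv_inv, smul_smul] at this
    rwa [mul_inv_cancel₀ b4.ne', one_smul] at this
  · have c1 : Tendsto (fun w => ℓ w) (𝓝 z₀) (𝓝 s₀) := ℓ.continuous.tendsto _
    have c2 : ∀ᶠ s in 𝓝 s₀, |τ s| < δ / 2 := by
      have : Tendsto (fun s => |τ s|) (𝓝 s₀) (𝓝 |τ s₀|) :=
        (hτd s₀).hasDerivAt.continuousAt.abs
      rw [hτ0, abs_zero] at this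
      exact this.eventually (gt_mem_nhds (by linarith))
    filter_upwards [c1.eventually c2, c1.eventually hθl, c1.eventually hIoo, hloc] with
      w w1 w2 w3 w4 hwc
    refine ⟨w1, ?_, ?_⟩
    · show β (θ (τ (ℓ w))) = w
      rw [w2, w4 hwc]
    · intro γ t hγ hd
      have w3' := Set.Ioo_subset_Icc_self w3
      have b4 := (hball _ (hmem _ w3')).2.2.2
      have h1 : HasDerivAt (fun s => ℓ (γ s)) (ℓ (hamiltonianField F w)) t :=
        ℓ.hasFDerivAt.comp_hasDerivAt t hd
      have h2 : HasDerivAt τ (h (ℓ (γ t))) (ℓ (γ t)) := (hτd _).hasDerivAt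
      have h3 := h2.comp t h1
      rw [hγ, heq _ w3'] at h3
      simp only [hq] at h3
      rw [w4 hwc] at h3 b4
      rwa [inv_mul_cancel₀ b4.ne'] at h3

/-! ### Trajectories and their uniqueness -/

/-- `γ` solves the Hamiltonian system of `F` on `s` and stays in the level set `{F = c}`. -/
def IsTrajectoryOn (F : ℝ × ℝ → ℝ) (c : ℝ) (γ : ℝ → ℝ × ℝ) (s : Set ℝ) : Prop :=
  ∀ t ∈ s, HasDerivAt γ (hamiltonianField F (γ t)) t ∧ F (γ t) = c

/-- `c` is a regular value of `F`. -/
def IsRegularLevel (F : ℝ × ℝ → ℝ) (c : ℝ) : Prop :=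
  ∀ z, F z = c → fderiv ℝ F z ≠ 0

namespace IsTrajectoryOn

variable {F : ℝ × ℝ → ℝ} {c : ℝ} {γ γ₁ γ₂ : ℝ → ℝ × ℝ} {s : Set ℝ}

lemma mono {t : Set ℝ} (h : IsTrajectoryOn F c γ s) (hts : t ⊆ s) : IsTrajectoryOn F c γ t :=
  fun x hx => h x (hts hx)

lemma congr_of_eventuallyEq {t : ℝ} (h : HasDerivAt γ₁ (hamiltonianField F (γ₁ t)) t ∧ F (γ₁ t) = c)
    (he : γ₂ =ᶠ[𝓝 t] γ₁) : HasDerivAt γ₂ (hamiltonianField F (γ₂ t)) t ∧ F (γ₂ t) = c := by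
  rw [he.self_of_nhds]
  exact ⟨h.1.congr_of_eventuallyEq he, h.2⟩

lemma comp_add_const (h : IsTrajectoryOn F c γ s) (a : ℝ) :
    IsTrajectoryOn F c (fun t => γ (t + a)) ((fun t => t + a) ⁻¹' s) := by
  intro t ht
  obtain ⟨h1, h2⟩ := h _ ht
  exact ⟨h1.comp_add_const t a, h2⟩

/-- The time coordinate `T` of a flow box has derivative 1 along both trajectories, so its two
values keep a constant difference, here zero; `α` recovers the point from its time. No Lipschitz
condition is needed. -/
lemma eventuallyEq (hF : ContDiff ℝ 1 F) (hreg : IsRegularLevel F c) (hs : IsOpen s)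
    (h₁ : IsTrajectoryOn F c γ₁ s) (h₂ : IsTrajectoryOn F c γ₂ s) {t : ℝ} (ht : t ∈ s)
    (h : γ₁ t = γ₂ t) : γ₁ =ᶠ[𝓝 t] γ₂ := by
  obtain ⟨δ, α, T, -, -, hbox⟩ := exists_flowBox hF (h₁ t ht).2 (hreg _ (h₁ t ht).2)
  have e1 := (h₁ t ht).1.continuousAt.eventually hbox
  have e2 := (h₂ t ht).1.continuousAt.eventually (by rw [← h]; exact hbox)
  obtain ⟨r, hr, hball⟩ := Metric.eventually_nhds_iff_ball.1
    ((hs.eventually_mem ht).and (e1.and e2))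
  have hd : ∀ u ∈ Metric.ball t r, HasDerivAt (fun u => T (γ₁ u) - T (γ₂ u)) 0 u := by
    intro u hu
    obtain ⟨k0, k1, k2⟩ := hball u hu
    have d1 := (k1 (h₁ u k0).2).2.2 γ₁ u rfl (h₁ u k0).1
    have d2 := (k2 (h₂ u k0).2).2.2 γ₂ u rfl (h₂ u k0).1
    have hd := d1.sub d2
    rw [sub_self] at hd
    exact hd
  filter_upwards [Metric.ball_mem_nhds t hr] with u hu
  have hconst := Metric.isOpen_ball.is_const_of_deriv_eq_zero
    (convex_ball t r).isPreconnected
    (fun v hv => (hd v hv).differentiableAt.differentiableWithinAt)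
    (fun v hv => (hd v hv).deriv) hu (Metric.mem_ball_self hr)
  simp only [h, sub_self] at hconst
  obtain ⟨k0, k1, k2⟩ := hball u hu
  rw [← (k1 (h₁ u k0).2).2.1, ← (k2 (h₂ u k0).2).2.1, sub_eq_zero.1 hconst]

lemma eqOn (hF : ContDiff ℝ 1 F) (hreg : IsRegularLevel F c) (hs : IsOpen s)
    (hs' : IsPreconnected s) (h₁ : IsTrajectoryOn F c γ₁ s) (h₂ : IsTrajectoryOn F c γ₂ s)
    {t : ℝ} (ht : t ∈ s) (h : γ₁ t = γ₂ t) : Set.EqOn γ₁ γ₂ s := by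
  have hsub : s ⊆ {u | γ₁ =ᶠ[𝓝 u] γ₂} := by
    refine hs'.subset_of_closure_inter_subset ?_ ⟨t, ht, eventuallyEq hF hreg hs h₁ h₂ ht h⟩ ?_
    · exact isOpen_setOfPred_eventually_nhds
    · rintro u ⟨hu, hus⟩
      refine eventuallyEq hF hreg hs h₁ h₂ hus ?_
      by_contra hne
      have hev : ∀ᶠ v in 𝓝 u, γ₁ v ≠ γ₂ v :=
        ((h₁ u hus).1.continuousAt.prodMk (h₂ u hus).1.continuousAt).eventually
          (isClosed_diagonal.isOpen_compl.mem_nhds (x := (γ₁ u, γ₂ u)) hne)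
      obtain ⟨v, hv1, hv2⟩ := mem_closure_iff_nhds.1 hu _ hev
      exact hv1 (hv2 : γ₁ =ᶠ[𝓝 v] γ₂).self_of_nhds
  exact fun u hu => (hsub hu : γ₁ =ᶠ[𝓝 u] γ₂).self_of_nhds

/-- Trajectories defined for all times that meet agree up to a time shift. -/
lemma eq_shift (hF : ContDiff ℝ 1 F) (hreg : IsRegularLevel F c)
    (h₁ : IsTrajectoryOn F c γ₁ Set.univ) (h₂ : IsTrajectoryOn F c γ₂ Set.univ) {a b : ℝ}
    (h : γ₁ a = γ₂ b) (t : ℝ) : γ₁ (t + a) = γ₂ (t + b) := by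
  have k1 := h₁.comp_add_const a
  have k2 := h₂.comp_add_const b
  rw [Set.preimage_univ] at k1 k2
  exact eqOn hF hreg isOpen_univ isPreconnected_univ k1 k2 (Set.mem_univ 0)
    (by simpa using h) (Set.mem_univ t)

end IsTrajectoryOn

/-! ### Trajectories for all times -/

lemma exists_uniform_time {F : ℝ × ℝ → ℝ} {c : ℝ} (hF : ContDiff ℝ 1 F)
    (hreg : IsRegularLevel F c) (hK : IsCompact {z | F z = c}) :
    ∃ ε > 0, ∀ z, F z = c →
      ∃ γ : ℝ → ℝ × ℝ, γ 0 = z ∧ IsTrajectoryOn F c γ (Set.Ioo (-ε) ε) := by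
  have := hK.induction_on (p := fun S => ∃ ε > 0, ∀ z ∈ S, F z = c →
      ∃ γ : ℝ → ℝ × ℝ, γ 0 = z ∧ IsTrajectoryOn F c γ (Set.Ioo (-ε) ε)) ⟨1, one_pos, by simp⟩
    (fun S S' hSS' ⟨ε, hε, h⟩ => ⟨ε, hε, fun z hz => h z (hSS' hz)⟩) ?_ ?_
  · obtain ⟨ε, hε, h⟩ := this
    exact ⟨ε, hε, fun z hz => h z hz hz⟩
  · rintro S S' ⟨ε, hε, h⟩ ⟨ε', hε', h'⟩
    refine ⟨min ε ε', lt_min hε hε', ?_⟩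
    rintro z (hz | hz) hzc
    · obtain ⟨γ, h0, hγ⟩ := h z hz hzc
      exact ⟨γ, h0, hγ.mono (Set.Ioo_subset_Ioo (neg_le_neg (min_le_left _ _)) (min_le_left _ _))⟩
    · obtain ⟨γ, h0, hγ⟩ := h' z hz hzc
      exact ⟨γ, h0, hγ.mono (Set.Ioo_subset_Ioo (neg_le_neg (min_le_right _ _)) (min_le_right _ _))⟩
  · intro z hz
    obtain ⟨δ, α, T, hδ, hα, hbox⟩ := exists_flowBox hF hz (hreg z hz)
    refine ⟨_, mem_nhdsWithin_of_mem_nhds hbox, δ / 2, by linarith, ?_⟩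
    intro w hw hwc
    obtain ⟨h1, h2, -⟩ := hw hwc
    rw [abs_lt] at h1
    refine ⟨fun t => α (t + T w), by simpa using h2, ?_⟩
    refine IsTrajectoryOn.mono (IsTrajectoryOn.comp_add_const hα (T w)) ?_
    intro t ht
    constructor <;> linarith [ht.1, ht.2]

/-- Restarting at times ±a/2 gains a/2 on each side, and uniqueness makes the pieces agree on
overlaps. The hypothesis covers all points of the level, so the extension can be iterated. -/
lemma exists_trajectoryOn_extend {F : ℝ × ℝ → ℝ} {c : ℝ} (hF : ContDiff ℝ 1 F)
    (hreg : IsRegularLevel F c) {a : ℝ} (ha : 0 < a)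
    (h : ∀ z, F z = c → ∃ γ : ℝ → ℝ × ℝ, γ 0 = z ∧ IsTrajectoryOn F c γ (Set.Ioo (-a) a))
    (z : ℝ × ℝ) (hz : F z = c) :
    ∃ γ : ℝ → ℝ × ℝ, γ 0 = z ∧ IsTrajectoryOn F c γ (Set.Ioo (-(3 / 2 * a)) (3 / 2 * a)) := by
  obtain ⟨γ, h0, hγ⟩ := h z hz
  have key : ∀ b ∈ Set.Ioo (-a) a, ∃ γ' : ℝ → ℝ × ℝ,
      IsTrajectoryOn F c γ' (Set.Ioo (b - a) (b + a)) ∧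
      Set.EqOn γ γ' (Set.Ioo (-a) a ∩ Set.Ioo (b - a) (b + a)) := by
    intro b hb
    obtain ⟨γ', h0', hγ'⟩ := h (γ b) (hγ b hb).2
    have hsh : IsTrajectoryOn F c (fun t => γ' (t + -b)) (Set.Ioo (b - a) (b + a)) := by
      refine (hγ'.comp_add_const (-b)).mono fun t ht => ?_
      constructor <;> linarith [ht.1, ht.2]
    refine ⟨_, hsh, ?_⟩
    refine IsTrajectoryOn.eqOn hF hreg (isOpen_Ioo.inter isOpen_Ioo)
      ((Set.ordConnected_Ioo.inter Set.ordConnected_Ioo).isPreconnected)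
      (hγ.mono Set.inter_subset_left) (hsh.mono Set.inter_subset_right)
      (t := b) ⟨hb, by constructor <;> linarith⟩ ?_
    simpa using h0'.symm
  obtain ⟨γp, hp, hpe⟩ := key (a / 2) ⟨by linarith, by linarith⟩
  obtain ⟨γm, hm, hme⟩ := key (-(a / 2)) ⟨by linarith, by linarith⟩
  let Γ : ℝ → ℝ × ℝ := fun t => if t < -(a / 2) then γm t else if t < a / 2 then γ t else γp t
  have eΓ : ∀ t ∈ Set.Ioo (-a) a, Γ t = γ t := by
    intro t ht
    simp only [Γ]
    split_ifs with h1 h2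
    · exact (hme ⟨ht, by constructor <;> linarith [ht.1, ht.2]⟩).symm
    · rfl
    · exact (hpe ⟨ht, by constructor <;> linarith [ht.1, ht.2]⟩).symm
  refine ⟨Γ, by rw [eΓ 0 ⟨by linarith, by linarith⟩, h0], ?_⟩
  intro t ht
  by_cases h1 : t ∈ Set.Ioo (-a) a
  · exact IsTrajectoryOn.congr_of_eventuallyEq (hγ t h1)
      (Filter.eventuallyEq_of_mem (isOpen_Ioo.mem_nhds h1) eΓ)
  · rcases lt_or_ge t 0 with h2 | h2
    · have h3 : t ≤ -a := by by_contra! h3; exact h1 ⟨h3, by linarith⟩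
      refine IsTrajectoryOn.congr_of_eventuallyEq
        (hm t ⟨by linarith [ht.1], by linarith⟩) ?_
      filter_upwards [gt_mem_nhds (show t < -(a / 2) by linarith)] with u hu
      simp [Γ, show u < -(a / 2) from hu]
    · have h3 : a ≤ t := by by_contra! h3; exact h1 ⟨by linarith, h3⟩
      refine IsTrajectoryOn.congr_of_eventuallyEq
        (hp t ⟨by linarith, by linarith [ht.2]⟩) ?_
      filter_upwards [lt_mem_nhds (show a / 2 < t by linarith)] with u hu
      have hu' : a / 2 < u := hu
      simp only [Γ]
      rw [if_neg (by linarith), if_neg (by linarith)]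

/-- Through every point of a compact regular level set there is a trajectory for all times. -/
lemma exists_trajectory {F : ℝ × ℝ → ℝ} {c : ℝ} (hF : ContDiff ℝ 1 F)
    (hreg : IsRegularLevel F c) (hK : IsCompact {z | F z = c}) (z : ℝ × ℝ) (hz : F z = c) :
    ∃ γ : ℝ → ℝ × ℝ, γ 0 = z ∧ IsTrajectoryOn F c γ Set.univ := by
  obtain ⟨ε, hε, h⟩ := exists_uniform_time hF hreg hK
  have hn : ∀ n : ℕ, ∀ z, F z = c → ∃ γ : ℝ → ℝ × ℝ, γ 0 = z ∧
      IsTrajectoryOn F c γ (Set.Ioo (-((3 / 2) ^ n * ε)) ((3 / 2) ^ n * ε)) := by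
    intro n
    induction n with
    | zero => simpa using h
    | succ n ih =>
      intro z hz
      have := exists_trajectoryOn_extend hF hreg (by positivity) ih z hz
      rwa [show (3 / 2 : ℝ) ^ (n + 1) * ε = 3 / 2 * ((3 / 2) ^ n * ε) by ring]
  choose γ h0 hγ using fun n => hn n z hz
  have hlarge : ∀ t : ℝ, ∃ n : ℕ, t ∈ Set.Ioo (-((3 / 2) ^ n * ε)) ((3 / 2) ^ n * ε) := by
    intro t
    obtain ⟨n, hn⟩ := pow_unbounded_of_one_lt (|t| / ε) (show (1 : ℝ) < 3 / 2 by norm_num)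
    exact ⟨n, abs_lt.1 ((div_lt_iff₀ hε).1 hn)⟩
  choose N hN using hlarge
  have heq : ∀ n t, t ∈ Set.Ioo (-((3 / 2) ^ n * ε)) ((3 / 2) ^ n * ε) → γ (N t) t = γ n t := by
    intro n t ht
    refine IsTrajectoryOn.eqOn hF hreg (isOpen_Ioo.inter isOpen_Ioo)
      ((Set.ordConnected_Ioo.inter Set.ordConnected_Ioo).isPreconnected)
      ((hγ (N t)).mono Set.inter_subset_left) ((hγ n).mono Set.inter_subset_right)
      (t := 0) ⟨?_, ?_⟩ (by rw [h0, h0]) ⟨hN t, ht⟩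
    · constructor <;> [rw [neg_lt_zero]; skip] <;> positivity
    · constructor <;> [rw [neg_lt_zero]; skip] <;> positivity
  refine ⟨fun t => γ (N t) t, h0 _, fun t _ => ?_⟩
  exact IsTrajectoryOn.congr_of_eventuallyEq (hγ (N t) t (hN t))
    (Filter.eventuallyEq_of_mem (isOpen_Ioo.mem_nhds (hN t)) fun u hu => heq _ u hu)

/-! ### Periodicity, regularity and finiteness of orbits -/

namespace IsTrajectoryOn

variable {F : ℝ × ℝ → ℝ} {c : ℝ} {γ γ₁ γ₂ : ℝ → ℝ × ℝ}

/-- A trajectory through `z` covers the level set near `z`, in a bounded time. -/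
lemma exists_eventually_mem_orbit (hF : ContDiff ℝ 1 F) (hreg : IsRegularLevel F c)
    (hγ : IsTrajectoryOn F c γ Set.univ) :
    ∃ δ > 0, ∀ᶠ w in 𝓝 (γ 0), F w = c → ∃ s, |s| < δ ∧ γ s = w := by
  have h0 := (hγ 0 (Set.mem_univ 0)).2
  obtain ⟨δ, α, T, hδ, hα, hbox⟩ := exists_flowBox hF h0 (hreg _ h0)
  refine ⟨δ, hδ, ?_⟩
  obtain ⟨z1, z2, -⟩ := hbox.self_of_nhds h0
  filter_upwards [hbox] with w hw hwc
  obtain ⟨w1, w2, -⟩ := hw hwc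
  rw [abs_lt] at z1 w1
  refine ⟨T w - T (γ 0), abs_lt.2 ⟨by linarith, by linarith⟩, ?_⟩
  have hα' : IsTrajectoryOn F c (fun t => α (t + T (γ 0)))
      (Set.Ioo (-δ - T (γ 0)) (δ - T (γ 0))) :=
    (IsTrajectoryOn.comp_add_const hα (T (γ 0))).mono fun t ht =>
      ⟨by linarith [ht.1], by linarith [ht.2]⟩
  have := eqOn hF hreg isOpen_Ioo isPreconnected_Ioo (hγ.mono (Set.subset_univ _)) hα' (t := 0)
    ⟨by linarith, by linarith⟩ (by simpa using z2.symm) (x := T w - T (γ 0))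
    ⟨by linarith, by linarith⟩
  rw [this]
  simpa using w2

lemma range_eq (hF : ContDiff ℝ 1 F) (hreg : IsRegularLevel F c)
    (h₁ : IsTrajectoryOn F c γ₁ Set.univ) (h₂ : IsTrajectoryOn F c γ₂ Set.univ) {a b : ℝ}
    (h : γ₁ a = γ₂ b) : Set.range γ₁ = Set.range γ₂ := by
  have key := eq_shift hF hreg h₁ h₂ h
  ext w
  constructor
  · rintro ⟨t, rfl⟩
    exact ⟨t - a + b, by rw [← key]; simp⟩
  · rintro ⟨t, rfl⟩
    exact ⟨t - b + a, by rw [key]; simp⟩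

/-- On a compact regular level set all trajectories are closed. -/
lemma exists_period (hF : ContDiff ℝ 1 F) (hreg : IsRegularLevel F c)
    (hK : IsCompact {z | F z = c}) (hγ : IsTrajectoryOn F c γ Set.univ) :
    ∃ T > 0, Function.Periodic γ T ∧ Set.InjOn γ (Set.Ico 0 T) := by
  let S : AddSubgroup ℝ :=
    { carrier := {a | Function.Periodic γ a}
      zero_mem' := fun t => by simp
      add_mem' := fun ha hb => Function.Periodic.add_period ha hb
      neg_mem' := fun ha => Function.Periodic.neg ha }
  -- By uniqueness, any return to a point is a period.
  have hS : ∀ {a b : ℝ}, γ a = γ b → b - a ∈ S := by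
    intro a b hab t
    have := eq_shift hF hreg hγ hγ hab (t - a)
    rw [sub_add_cancel] at this
    rw [this]
    congr 1
    ring
  have hd : HasDerivAt γ (hamiltonianField F (γ 0)) 0 := (hγ 0 (Set.mem_univ 0)).1
  have hX : hamiltonianField F (γ 0) ≠ 0 :=
    hamiltonianField_ne_zero (hreg _ (hγ 0 (Set.mem_univ 0)).2)
  -- Nonzero velocity forbids arbitrarily small positive periods, so the group of periods is
  -- discrete.
  have hnd : ¬ Dense (S : Set ℝ) := by
    intro hdense
    have hev := hd.eventually_ne hX (c := γ 0)
    rw [eventually_nhdsWithin_iff] at hev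
    obtain ⟨r, hr, hball⟩ := Metric.eventually_nhds_iff_ball.1 hev
    obtain ⟨a, ha, haS⟩ := hdense.exists_mem_open (isOpen_Ioo (a := 0) (b := r))
      ⟨r / 2, by constructor <;> linarith⟩
    refine hball a ?_ haS.1.ne' ?_
    · rw [Metric.mem_ball, Real.dist_eq, sub_zero, abs_of_pos haS.1]
      exact haS.2
    · simpa using (ha : Function.Periodic γ a) 0
  -- By compactness the points γ(n) accumulate at some `z`. The orbit of `z` passes through both γ(u
  -- n) and γ(u (n+k)) within time δ, so (u (n+k) - s') - (u n - s) is a period; it is positive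
  -- since k > 2δ.
  have hper : ∃ a ∈ S, a ≠ 0 := by
    obtain ⟨z, hz, u, hu, hlim⟩ := hK.tendsto_subseq (x := fun n : ℕ => γ n)
      fun n => (hγ n (Set.mem_univ _)).2
    obtain ⟨ζ, h0, hζ⟩ := exists_trajectory hF hreg hK z hz
    obtain ⟨δ, hδ, hbox⟩ := exists_eventually_mem_orbit hF hreg hζ
    rw [h0] at hbox
    obtain ⟨n, hn⟩ := eventually_atTop.1 (hlim.eventually hbox)
    obtain ⟨k, hk⟩ := exists_nat_gt (2 * δ)
    obtain ⟨s, hs, hs'⟩ := hn n le_rfl (hγ _ (Set.mem_univ _)).2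
    obtain ⟨s', hs1, hs1'⟩ := hn (n + k) (by omega) (hγ _ (Set.mem_univ _)).2
    have e1 := eq_shift hF hreg hζ hγ hs' (-s)
    have e2 := eq_shift hF hreg hζ hγ hs1' (-s')
    simp only [neg_add_cancel] at e1 e2
    refine ⟨_, hS (e1.symm.trans e2), ?_⟩
    have hu' : (u n : ℝ) + k ≤ u (n + k) := by
      have := hu.add_le_nat k n
      rw [add_comm n k, add_comm (u n : ℝ)]
      exact_mod_cast this
    rw [abs_lt] at hs hs1
    have : 0 < -s' + (u (n + k) : ℝ) - (-s + (u n : ℝ)) := by linarith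
    exact this.ne'
  obtain ⟨a, haS⟩ := S.dense_or_cyclic.resolve_left hnd
  have hmem : ∀ x, x ∈ S ↔ ∃ k : ℤ, k • a = x := by
    intro x
    rw [haS, AddSubgroup.mem_closure_singleton]
  have ha0 : a ≠ 0 := by
    rintro rfl
    obtain ⟨b, hb, hb0⟩ := hper
    obtain ⟨k, hk⟩ := (hmem b).1 hb
    exact hb0 (by simpa using hk.symm)
  have haS' : |a| ∈ S := by
    rcases abs_choice a with h | h <;> rw [h]
    · exact (hmem a).2 ⟨1, one_smul _ _⟩
    · exact S.neg_mem ((hmem a).2 ⟨1, one_smul _ _⟩)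
  refine ⟨|a|, abs_pos.2 ha0, haS', ?_⟩
  intro u hu v hv huv
  obtain ⟨k, hk⟩ := (hmem _).1 (hS huv)
  have hlt : |v - u| < |a| := abs_lt.2 ⟨by linarith [hu.2, hv.1], by linarith [hu.1, hv.2]⟩
  rw [← hk, zsmul_eq_mul, abs_mul] at hlt
  have hk1 : |(k : ℝ)| < 1 := by
    by_contra! h
    nlinarith [abs_pos.2 ha0]
  have hk0 : k = 0 := by
    rw [← Int.cast_abs] at hk1
    exact Int.abs_lt_one_iff.1 (by exact_mod_cast hk1)
  rw [hk0, zero_smul] at hk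
  linarith

/-- The regularity of a trajectory. -/
lemma contDiff {r : ℕ∞} (hF : ContDiff ℝ r F)
    (hγ : IsTrajectoryOn F c γ Set.univ) : ContDiff ℝ r γ := by
  have hd : ∀ t, HasDerivAt γ (hamiltonianField F (γ t)) t := fun t => (hγ t (Set.mem_univ t)).1
  have hderiv : deriv γ = fun t => hamiltonianField F (γ t) := funext fun t => (hd t).deriv
  have hdiff : Differentiable ℝ γ := fun t => (hd t).differentiableAt
  rw [contDiff_iff_forall_nat_le]
  -- Bootstrap: if γ is C^k and F is C^(k+1), then γ' is the C^k field evaluated along γ, so γ is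
  -- C^(k+1).
  intro k
  induction k with
  | zero => exact fun _ => contDiff_zero.2 hdiff.continuous
  | succ k ih =>
    intro hk
    have ihk := ih (le_trans (by exact_mod_cast Nat.le_succ k) hk)
    have hFk : ContDiff ℝ ((k : WithTop ℕ∞) + 1) F := hF.of_le (by exact_mod_cast hk)
    have hF' : ContDiff ℝ k (fderiv ℝ F) := hFk.fderiv_right le_rfl
    have : ContDiff ℝ ((k : WithTop ℕ∞) + 1) γ := by
      rw [contDiff_succ_iff_deriv]
      refine ⟨hdiff, by simp, ?_⟩
      rw [hderiv]
      have h1 : ContDiff ℝ k fun t => fderiv ℝ F (γ t) := hF'.comp ihk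
      exact ((h1.clm_apply contDiff_const).neg).prodMk (h1.clm_apply contDiff_const)
    exact_mod_cast this

end IsTrajectoryOn

/-- A compact regular level set is a finite disjoint union of closed trajectories. -/
theorem exists_closed_trajectories {F : ℝ × ℝ → ℝ} {c : ℝ} (hF : ContDiff ℝ 1 F)
    (hreg : IsRegularLevel F c) (hK : IsCompact {z | F z = c}) :
    ∃ (N : ℕ) (K : Fin N → Set (ℝ × ℝ)), {z | F z = c} = ⋃ i, K i ∧
      Pairwise (fun i i' => Disjoint (K i) (K i')) ∧
      ∀ i, ∃ γ : ℝ → ℝ × ℝ, IsTrajectoryOn F c γ Set.univ ∧ Set.range γ = K i := by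
  choose! γ h0 hγ using exists_trajectory hF hreg hK
  -- All level points near `z` lie on the orbit of `z`, so each point has a neighbourhood
  -- contributing one orbit, and compactness leaves finitely many.
  have hfin : ((fun z => Set.range (γ z)) '' {z | F z = c}).Finite := by
    refine hK.induction_on (p := fun S => ((fun z => Set.range (γ z)) '' S).Finite) (by simp)
      (fun S S' hS h => h.subset (Set.image_mono hS))
      (fun S S' h h' => by rw [Set.image_union]; exact h.union h') ?_
    intro z hz
    obtain ⟨δ, -, hbox⟩ := (hγ z hz).exists_eventually_mem_orbit hF hreg
    rw [h0 z hz] at hbox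
    refine ⟨{w | F w = c ∧ ∃ s, |s| < δ ∧ γ z s = w}, ?_, ?_⟩
    · filter_upwards [mem_nhdsWithin_of_mem_nhds hbox, self_mem_nhdsWithin] with w hw hwc
      exact ⟨hwc, hw hwc⟩
    · refine (Set.finite_singleton (Set.range (γ z))).subset ?_
      rintro _ ⟨w, ⟨hwc, s, -, hs⟩, rfl⟩
      exact (hγ w hwc).range_eq hF hreg (hγ z hz) (a := 0) (b := s) (by rw [h0 w hwc, hs])
  have := hfin.to_subtype
  obtain ⟨N, ⟨e⟩⟩ := Finite.exists_equiv_fin ((fun z => Set.range (γ z)) '' {z | F z = c})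
  refine ⟨N, fun i => (e.symm i).1, ?_, ?_, ?_⟩
  · ext z
    simp only [Set.mem_iUnion]
    constructor
    · intro hz
      refine ⟨e ⟨_, z, hz, rfl⟩, ?_⟩
      rw [Equiv.symm_apply_apply]
      exact ⟨0, h0 z hz⟩
    · rintro ⟨i, hi⟩
      obtain ⟨w, hw, hw'⟩ := (e.symm i).2
      rw [← hw'] at hi
      obtain ⟨t, rfl⟩ := hi
      exact (hγ w hw t (Set.mem_univ t)).2
  · intro i i' hne
    rw [Set.disjoint_left]
    intro z hz hz'
    obtain ⟨w, hw, hw'⟩ := (e.symm i).2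
    obtain ⟨v, hv, hv'⟩ := (e.symm i').2
    refine hne (e.symm.injective (Subtype.ext ?_))
    change z ∈ (e.symm i).1 at hz
    change z ∈ (e.symm i').1 at hz'
    rw [← hw'] at hz
    rw [← hv'] at hz'
    obtain ⟨a, ha⟩ := hz
    obtain ⟨b, hb⟩ := hz'
    rw [← hw', ← hv']
    exact (hγ w hw).range_eq hF hreg (hγ v hv) (ha.trans hb.symm)
  · intro i
    obtain ⟨w, hw, hw'⟩ := (e.symm i).2
    exact ⟨γ w, hγ w hw, hw'⟩

/-! ### Reflection in the axis and symmetry of the orbits -/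

lemma hamiltonianField_reflect {F : ℝ × ℝ → ℝ} (hF : ContDiff ℝ 1 F)
    (heven : ∀ x σ, F (x, -σ) = F (x, σ)) (z : ℝ × ℝ) :
    hamiltonianField F (z.1, -z.2) = (-(hamiltonianField F z).1, (hamiltonianField F z).2) := by
  let R : ℝ × ℝ →L[ℝ] ℝ × ℝ :=
    (ContinuousLinearMap.fst ℝ ℝ ℝ).prod (-ContinuousLinearMap.snd ℝ ℝ ℝ)
  have hFR : F ∘ R = F := funext fun w => heven w.1 w.2
  have hd := ((hF.differentiable one_ne_zero (R z)).hasFDerivAt.comp z R.hasFDerivAt)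
  rw [hFR] at hd
  have h : fderiv ℝ F z = (fderiv ℝ F (R z)).comp R := hd.fderiv
  have hz : ((z.1, -z.2) : ℝ × ℝ) = R z := rfl
  have e1 : R (0, 1) = -((0 : ℝ), (1 : ℝ)) := by ext <;> simp [R]
  have e2 : R (1, 0) = ((1 : ℝ), (0 : ℝ)) := by ext <;> simp [R]
  rw [hz]
  simp only [hamiltonianField, h, ContinuousLinearMap.comp_apply, e1, e2, map_neg, neg_neg]

namespace IsTrajectoryOn

variable {F : ℝ × ℝ → ℝ} {c : ℝ} {γ : ℝ → ℝ × ℝ}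

/-- Reflection flips the horizontal component of the field but the vertical component of velocities;
reversing time reconciles the two. -/
lemma reflect (hF : ContDiff ℝ 1 F) (heven : ∀ x σ, F (x, -σ) = F (x, σ))
    (hγ : IsTrajectoryOn F c γ Set.univ) :
    IsTrajectoryOn F c (fun t => ((γ (-t)).1, -(γ (-t)).2)) Set.univ := by
  intro t _
  obtain ⟨h1, h2⟩ := hγ (-t) (Set.mem_univ _)
  refine ⟨?_, by rw [heven]; exact h2⟩
  rw [hamiltonianField_reflect hF heven]
  have h3 : HasDerivAt (fun t => γ (-t)) (-(hamiltonianField F (γ (-t)))) t := by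
    have h := h1.scomp t (hasDerivAt_neg t)
    rw [neg_smul, one_smul] at h
    exact h
  have h4 := (ContinuousLinearMap.fst ℝ ℝ ℝ).hasFDerivAt.comp_hasDerivAt t h3
  have h5 := (ContinuousLinearMap.snd ℝ ℝ ℝ).hasFDerivAt.comp_hasDerivAt t h3
  have h6 := h4.prodMk h5.neg
  simpa using h6

/-- If a function `P` grows along the trajectories at the rate `σ (∂F/∂x)²`, then no closed
trajectory stays in one of the two open half planes. -/
lemma exists_snd_eq_zero (hreg : IsRegularLevel F c)
    (hγ : IsTrajectoryOn F c γ Set.univ) {T : ℝ} (hT : 0 < T) (hper : Function.Periodic γ T)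
    {P : ℝ × ℝ → ℝ}
    (hP : ∀ t, HasDerivAt (fun s => P (γ s)) ((γ t).2 * (hamiltonianField F (γ t)).2 ^ 2) t) :
    ∃ t, (γ t).2 = 0 := by
  by_contra! hne
  have hcont : Continuous γ :=
    continuous_iff_continuousAt.2 fun t => (hγ t (Set.mem_univ t)).1.continuousAt
  have hsign : (∀ t, 0 ≤ (γ t).2) ∨ ∀ t, (γ t).2 ≤ 0 := by
    by_contra! h
    obtain ⟨⟨a, ha⟩, b, hb⟩ := h
    obtain ⟨t, ht⟩ := mem_range_of_exists_le_of_exists_ge (f := fun t => (γ t).2) (c := 0)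
      (by fun_prop) ⟨a, ha.le⟩ ⟨b, hb.le⟩
    exact hne t ht
  have hperP : ∀ (n : ℕ) t, P (γ (t + n * T)) = P (γ t) := by
    intro n t
    rw [hper.nat_mul n t]
  -- A monotone function with arbitrarily large periods is constant.
  have hsandwich : ∀ Q : ℝ → ℝ, (Monotone Q ∨ Antitone Q) → (∀ (n : ℕ) t, Q (t + n * T) = Q t) →
      ∀ a b, Q a = Q b := by
    have aux : ∀ Q : ℝ → ℝ, Monotone Q → (∀ (n : ℕ) t, Q (t + n * T) = Q t) →
        ∀ a b, Q a ≤ Q b := by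
      intro Q hQ hQp a b
      obtain ⟨n, hn⟩ := exists_nat_gt ((a - b) / T)
      rw [div_lt_iff₀ hT] at hn
      rw [← hQp n b]
      exact hQ (by linarith)
    intro Q hQ hQp a b
    rcases hQ with hQ | hQ
    · exact le_antisymm (aux Q hQ hQp a b) (aux Q hQ hQp b a)
    · have h1 := aux (fun t => -Q t) hQ.neg (fun n t => by simp only [hQp])
      have h2 := h1 a b
      have h3 := h1 b a
      linarith
  have hconst := hsandwich (fun t => P (γ t)) (by
    rcases hsign with h | h
    · exact Or.inl (monotone_of_hasDerivAt_nonneg hP fun t => mul_nonneg (h t) (sq_nonneg _))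
    · exact Or.inr (antitone_of_hasDerivAt_nonpos hP fun t =>
        mul_nonpos_of_nonpos_of_nonneg (h t) (sq_nonneg _))) hperP
  have hX2 : ∀ t, (hamiltonianField F (γ t)).2 = 0 := by
    intro t
    have h0 : HasDerivAt (fun s => P (γ s)) 0 t := by
      have : (fun s => P (γ s)) = fun _ => P (γ 0) := funext fun s => hconst s 0
      rw [this]
      exact hasDerivAt_const _ _
    have := (hP t).unique h0
    exact pow_eq_zero_iff two_ne_zero |>.1 ((mul_eq_zero.1 this).resolve_left (hne t))
  have hX1 : ∀ t, (hamiltonianField F (γ t)).1 ≠ 0 := by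
    intro t h
    exact hamiltonianField_ne_zero (hreg _ (hγ t (Set.mem_univ t)).2) (Prod.ext h (hX2 t))
  have hd : ∀ t, HasDerivAt (fun s => (γ s).1) (hamiltonianField F (γ t)).1 t := fun t =>
    (ContinuousLinearMap.fst ℝ ℝ ℝ).hasFDerivAt.comp_hasDerivAt t (hγ t (Set.mem_univ t)).1
  -- Rolle's theorem for the periodic first coordinate, whose derivative never vanishes.
  obtain ⟨t, -, ht⟩ := exists_hasDerivAt_eq_zero (f := fun s => (γ s).1) (a := 0) (b := T) hT
    (by fun_prop) (by have := hper 0; rw [zero_add] at this; simp [this]) fun t _ => hd t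
  exact hX1 t ht

end IsTrajectoryOn

/-- A compact regular level set of an even function is a finite disjoint union of symmetric closed
curves, if a function `P` grows along the trajectories at the rate `σ (∂F/∂x)²`. -/
theorem exists_symmetric_closedCurves {F P : ℝ × ℝ → ℝ} {c : ℝ} {r : ℕ∞} (hr : 1 ≤ r)
    (hF : ContDiff ℝ r F) (hreg : IsRegularLevel F c) (hK : IsCompact {z | F z = c})
    (heven : ∀ x σ, F (x, -σ) = F (x, σ))
    (hP : ∀ γ, IsTrajectoryOn F c γ Set.univ → ∀ t,
      HasDerivAt (fun s => P (γ s)) ((γ t).2 * (hamiltonianField F (γ t)).2 ^ 2) t) :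
    ∃ (N : ℕ) (K : Fin N → Set (ℝ × ℝ)), {z | F z = c} = ⋃ i, K i ∧
      Pairwise (fun i i' => Disjoint (K i) (K i')) ∧
      ∀ i, IsClosedCurve r (K i) ∧ IsSymmetric (K i) := by
  have hF1 : ContDiff ℝ 1 F := hF.of_le (by exact_mod_cast hr)
  obtain ⟨N, K, hU, hdisj, hKγ⟩ := exists_closed_trajectories hF1 hreg hK
  refine ⟨N, K, hU, hdisj, fun i => ?_⟩
  obtain ⟨γ, hγ, hrange⟩ := hKγ i
  obtain ⟨T, hT, hper, hinj⟩ := hγ.exists_period hF1 hreg hK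
  refine ⟨⟨T, γ, hT, hγ.contDiff hF, hper, fun t => ?_, hinj, hrange⟩, ?_⟩
  · obtain ⟨h1, h2⟩ := hγ t (Set.mem_univ t)
    rw [h1.deriv]
    exact hamiltonianField_ne_zero (hreg _ h2)
  · obtain ⟨t, ht⟩ := hγ.exists_snd_eq_zero hreg hT hper (hP γ hγ)
    have hR := hγ.reflect hF1 heven
    have hreq := hR.range_eq hF1 hreg hγ (a := -t) (b := t) (by
      ext <;> simp [ht])
    rw [hrange] at hreq
    have key : ∀ x σ, (x, σ) ∈ K i → (x, -σ) ∈ K i := by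
      intro x σ h
      rw [← hrange] at h
      obtain ⟨s, hs⟩ := h
      rw [← hreq]
      exact ⟨-s, by simp [hs]⟩
    exact fun x σ => ⟨key x σ, fun h => by simpa using key _ _ h⟩

/-! ### Heat waves and the potential -/

/-- The exponent `iωx - (ωσ)²/2` of a heat wave. -/
noncomputable def heatPhase (ω : ℝ) (z : ℝ × ℝ) : ℂ :=
  (ω * z.1 : ℝ) * Complex.I - ((ω * z.2) ^ 2 / 2 : ℝ)

/-- The superposition `∫ g(ω) exp(iωx - (ωσ)²/2) dω` of heat waves. -/
noncomputable def heatTransform (g : ℝ → ℂ) (z : ℝ × ℝ) : ℂ :=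
  ∫ ω : ℝ, g ω * Complex.exp (heatPhase ω z)

lemma norm_exp_heatPhase (ω : ℝ) (z : ℝ × ℝ) :
    ‖Complex.exp (heatPhase ω z)‖ = Real.exp (-((ω * z.2) ^ 2 / 2)) := by
  rw [Complex.norm_exp]
  congr 1
  simp only [heatPhase, Complex.sub_re, Complex.ofReal_re, Complex.re_ofReal_mul, Complex.I_re]
  ring

lemma norm_exp_heatPhase_le (ω : ℝ) (z : ℝ × ℝ) : ‖Complex.exp (heatPhase ω z)‖ ≤ 1 := by
  rw [norm_exp_heatPhase, Real.exp_le_one_iff, neg_nonpos]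
  positivity

lemma continuous_heatPhase (z : ℝ × ℝ) : Continuous fun ω => heatPhase ω z := by
  unfold heatPhase
  fun_prop

lemma aestronglyMeasurable_exp_heatPhase (z : ℝ × ℝ) :
    AEStronglyMeasurable (fun ω => Complex.exp (heatPhase ω z)) :=
  (Complex.continuous_exp.comp (continuous_heatPhase z)).aestronglyMeasurable

lemma integrable_mul_exp_heatPhase {g : ℝ → ℂ} (hg : Integrable g) (z : ℝ × ℝ) :
    Integrable fun ω => g ω * Complex.exp (heatPhase ω z) := by
  refine hg.norm.mono' (hg.1.mul (aestronglyMeasurable_exp_heatPhase z)) (.of_forall fun ω => ?_)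
  rw [norm_mul]
  exact mul_le_of_le_one_right (norm_nonneg _) (norm_exp_heatPhase_le ω z)

lemma ae_ne_zero_real : ∀ᵐ ω : ℝ, ω ≠ 0 :=
  compl_mem_ae_iff.2 (measure_singleton (0 : ℝ))

/-- The factor of the spectrum that corresponds to differentiation in `x`. -/
noncomputable def spectralDeriv (g : ℝ → ℂ) (ω : ℝ) : ℂ := Complex.I * ω * g ω

lemma hasDerivAt_heatTransform_fst {g : ℝ → ℂ} (hg : Integrable g)
    (hg' : Integrable (spectralDeriv g)) (x σ : ℝ) :
    HasDerivAt (fun y => heatTransform g (y, σ)) (heatTransform (spectralDeriv g) (x, σ)) x := by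
  refine (hasDerivAt_integral_of_dominated_loc_of_deriv_le
    (F := fun (y : ℝ) (ω : ℝ) => g ω * Complex.exp (heatPhase ω (y, σ)))
    (F' := fun (y : ℝ) (ω : ℝ) => spectralDeriv g ω * Complex.exp (heatPhase ω (y, σ)))
    (bound := fun ω => ‖spectralDeriv g ω‖) (s := Set.univ) univ_mem
    (.of_forall fun y => (integrable_mul_exp_heatPhase hg _).1)
    (integrable_mul_exp_heatPhase hg _) (integrable_mul_exp_heatPhase hg' _).1
    (.of_forall fun ω y _ => ?_) hg'.norm (.of_forall fun ω y _ => ?_)).2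
  · rw [norm_mul]
    exact mul_le_of_le_one_right (norm_nonneg _) (norm_exp_heatPhase_le ω _)
  · have h1 : HasDerivAt (fun y : ℝ => heatPhase ω (y, σ)) (ω * Complex.I) y := by
      unfold heatPhase
      have h2 : HasDerivAt (fun y : ℝ => ((ω * y : ℝ) : ℂ)) ω y := by
        have := ((hasDerivAt_id y).const_mul ω).ofReal_comp
        simpa using this
      exact (h2.mul_const Complex.I).sub_const (((ω * σ) ^ 2 / 2 : ℝ) : ℂ)
    have h3 := (h1.cexp).const_mul (g ω)
    refine h3.congr_deriv ?_
    simp only [spectralDeriv]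
    ring

lemma norm_exp_sub_one_le_of_re_nonpos {w : ℂ} (hw : w.re ≤ 0) :
    ‖Complex.exp w - 1‖ ≤ 2 * ‖w‖ := by
  rcases le_total ‖w‖ 1 with h | h
  · exact Complex.norm_exp_sub_one_le h
  · have h1 : ‖Complex.exp w‖ ≤ 1 := by
      rw [Complex.norm_exp]
      exact Real.exp_le_one_iff.2 hw
    calc ‖Complex.exp w - 1‖ ≤ ‖Complex.exp w‖ + ‖(1 : ℂ)‖ := norm_sub_le _ _
      _ ≤ 2 * ‖w‖ := by rw [norm_one]; linarith

/-- A function whose differential is `H dx + σ ∂H/∂x dσ`, where `H` is the superposition of the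
heat waves with spectrum `g`. -/
noncomputable def heatPotential (g : ℝ → ℂ) (z : ℝ × ℝ) : ℂ :=
  ∫ ω : ℝ, g ω * ((Complex.exp (heatPhase ω z) - 1) / (Complex.I * ω))

/-- The subtracted 1 cancels the pole at ω = 0: |e^w - 1| ≤ 2|w| for Re w ≤ 0, and the phase is
divisible by ω. Only `g` and ωg need be integrable. -/
lemma integrable_heatPotential {g : ℝ → ℂ} (hg : Integrable g)
    (hg' : Integrable (spectralDeriv g)) (z : ℝ × ℝ) :
    Integrable fun ω : ℝ => g ω * ((Complex.exp (heatPhase ω z) - 1) / (Complex.I * ω)) := by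
  have hb : Integrable fun ω => 2 * |z.1| * ‖g ω‖ + z.2 ^ 2 * ‖spectralDeriv g ω‖ :=
    (hg.norm.const_mul _).add (hg'.norm.const_mul _)
  refine hb.mono' ?_ ?_
  · refine hg.1.mul (AEMeasurable.aestronglyMeasurable ?_)
    have := ((Complex.continuous_exp.comp (continuous_heatPhase z)).measurable.sub_const 1)
    exact (this.div (by fun_prop)).aemeasurable
  · filter_upwards [ae_ne_zero_real] with ω hω
    have hre : (heatPhase ω z).re ≤ 0 := by
      have := norm_exp_heatPhase_le ω z
      rwa [Complex.norm_exp, Real.exp_le_one_iff] at this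
    have h1 := norm_exp_sub_one_le_of_re_nonpos hre
    have h2 : ‖heatPhase ω z‖ ≤ |ω| * |z.1| + (|ω| * |z.2|) ^ 2 / 2 := by
      unfold heatPhase
      refine (norm_sub_le _ _).trans ?_
      rw [norm_mul, Complex.norm_I, mul_one, Complex.norm_real, Complex.norm_real,
        Real.norm_eq_abs, Real.norm_eq_abs, abs_mul, abs_div, abs_pow, abs_mul]
      simp
    have hω' : 0 < |ω| := abs_pos.2 hω
    simp only [norm_mul, norm_div, spectralDeriv, Complex.norm_I, one_mul, Complex.norm_real,
      Real.norm_eq_abs]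
    calc ‖g ω‖ * (‖Complex.exp (heatPhase ω z) - 1‖ / |ω|)
        ≤ ‖g ω‖ * ((2 * (|ω| * |z.1| + (|ω| * |z.2|) ^ 2 / 2)) / |ω|) := by
          gcongr
          exact h1.trans (by gcongr)
      _ = 2 * |z.1| * ‖g ω‖ + z.2 ^ 2 * (|ω| * ‖g ω‖) := by
          rw [← sq_abs z.2]
          field_simp

/-- The chain rule under the integral: -ω²/(iω) = iω turns the σ-term into the x-derivative of the
transform. Working along a curve avoids any second derivative in x, which need not exist. -/
lemma hasDerivAt_heatPotential_comp {g : ℝ → ℂ} (hg : Integrable g)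
    (hg' : Integrable (spectralDeriv g)) {γ γ' : ℝ → ℝ × ℝ} (hγ : ∀ t, HasDerivAt γ (γ' t) t)
    (hc : Continuous γ') (t : ℝ) :
    HasDerivAt (fun s => heatPotential g (γ s))
      (heatTransform g (γ t) * (γ' t).1 +
        heatTransform (spectralDeriv g) (γ t) * ((γ t).2 * (γ' t).2 : ℝ)) t := by
  set B := ‖γ' t‖ + 1
  set C := ‖γ t‖ + 1
  have hγc : Continuous γ := continuous_iff_continuousAt.2 fun s => (hγ s).continuousAt
  have hS : {s | ‖γ' s‖ < B ∧ ‖γ s‖ < C} ∈ 𝓝 t := by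
    have h1 := hc.norm.continuousAt.eventually (gt_mem_nhds (show ‖γ' t‖ < B by simp [B]))
    have h2 := hγc.norm.continuousAt.eventually (gt_mem_nhds (show ‖γ t‖ < C by simp [C]))
    exact h1.and h2
  have hfst : ∀ w : ℝ × ℝ, |w.1| ≤ ‖w‖ := fun w => norm_fst_le w
  have hsnd : ∀ w : ℝ × ℝ, |w.2| ≤ ‖w‖ := fun w => norm_snd_le w
  set F' : ℝ → ℝ → ℂ := fun s ω => g ω * Complex.exp (heatPhase ω (γ s)) * (γ' s).1 +
    spectralDeriv g ω * Complex.exp (heatPhase ω (γ s)) * ((γ s).2 * (γ' s).2 : ℝ) with hF'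
  have i1 := (integrable_mul_exp_heatPhase hg (γ t)).mul_const ((γ' t).1 : ℂ)
  have i2 := (integrable_mul_exp_heatPhase hg' (γ t)).mul_const (((γ t).2 * (γ' t).2 : ℝ) : ℂ)
  have key := (hasDerivAt_integral_of_dominated_loc_of_deriv_le
    (F := fun (s : ℝ) (ω : ℝ) =>
      g ω * ((Complex.exp (heatPhase ω (γ s)) - 1) / (Complex.I * ω)))
    (F' := F')
    (bound := fun ω => ‖g ω‖ * B + ‖spectralDeriv g ω‖ * (C * B)) hS
    (.of_forall fun s => (integrable_heatPotential hg hg' _).1)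
    (integrable_heatPotential hg hg' _) (i1.add i2).1
    (.of_forall fun ω s hs => ?_) ((hg.norm.mul_const _).add (hg'.norm.mul_const _)) ?_).2
  · have e : ∫ ω, F' t ω = heatTransform g (γ t) * (γ' t).1 +
        heatTransform (spectralDeriv g) (γ t) * ((γ t).2 * (γ' t).2 : ℝ) := by
      simp only [hF']
      rw [integral_add i1 i2, integral_mul_const, integral_mul_const]
      rfl
    rw [← e]
    exact key
  · obtain ⟨hs1, hs2⟩ := hs
    simp only [hF']
    refine (norm_add_le _ _).trans (add_le_add ?_ ?_)
    · rw [norm_mul, norm_mul, Complex.norm_real, Real.norm_eq_abs]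
      exact mul_le_mul (mul_le_of_le_one_right (norm_nonneg _) (norm_exp_heatPhase_le ω _))
        ((hfst _).trans hs1.le) (abs_nonneg _) (norm_nonneg _)
    · rw [norm_mul, norm_mul, Complex.norm_real, Real.norm_eq_abs, abs_mul]
      exact mul_le_mul (mul_le_of_le_one_right (norm_nonneg _) (norm_exp_heatPhase_le ω _))
        (mul_le_mul ((hsnd _).trans hs2.le) ((hsnd _).trans hs1.le) (abs_nonneg _)
          (by positivity)) (by positivity) (norm_nonneg _)
  · filter_upwards [ae_ne_zero_real] with ω hω s _
    have h1 : HasDerivAt (fun s => (γ s).1) (γ' s).1 s :=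
      (ContinuousLinearMap.fst ℝ ℝ ℝ).hasFDerivAt.comp_hasDerivAt s (hγ s)
    have h2 : HasDerivAt (fun s => (γ s).2) (γ' s).2 s :=
      (ContinuousLinearMap.snd ℝ ℝ ℝ).hasFDerivAt.comp_hasDerivAt s (hγ s)
    have h3 : HasDerivAt (fun s => heatPhase ω (γ s))
        ((ω * (γ' s).1 : ℝ) * Complex.I - (ω ^ 2 * ((γ s).2 * (γ' s).2) : ℝ)) s := by
      unfold heatPhase
      refine ((h1.const_mul ω).ofReal_comp.mul_const Complex.I).sub ?_
      have h4 : HasDerivAt (fun s => (ω * (γ s).2) ^ 2 / 2) (ω ^ 2 * ((γ s).2 * (γ' s).2)) s := by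
        have := ((h2.const_mul ω).pow 2).div_const 2
        refine this.congr_deriv ?_
        push_cast
        ring
      exact h4.ofReal_comp
    have h5 := ((h3.cexp.sub_const 1).div_const (Complex.I * ω)).const_mul (g ω)
    refine h5.congr_deriv ?_
    have hω' : (ω : ℂ) ≠ 0 := Complex.ofReal_ne_zero.2 hω
    simp only [hF', spectralDeriv]
    push_cast
    field_simp
    ring_nf
    simp only [Complex.I_sq]
    ring

/-! ### Heat superpositions as planar Fourier transforms -/

/-- The density on the frequency plane whose Fourier transform is `heatTransform g`. -/
noncomputable def heatDensity (g : ℝ → ℂ) (v : ℝ × ℝ) : ℂ :=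
  g v.1 * ((|v.1|⁻¹ * Real.exp (-(1 / 2) * (v.1⁻¹ * v.2) ^ 2) * (√(2 * Real.pi))⁻¹ : ℝ) : ℂ)

lemma aestronglyMeasurable_heatDensity {g : ℝ → ℂ} (hg : AEStronglyMeasurable g) :
    AEStronglyMeasurable (heatDensity g) (volume.prod volume) := by
  refine hg.comp_fst.mul (Measurable.aestronglyMeasurable ?_)
  fun_prop

lemma integrable_max_pow_mul_exp (n : ℕ) :
    Integrable fun ξ : ℝ => max 1 |ξ| ^ n * Real.exp (-(1 / 2) * ξ ^ 2) := by
  have h1 : Integrable fun ξ : ℝ => Real.exp (-(1 / 2) * ξ ^ 2) :=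
    integrable_exp_neg_mul_sq (by norm_num)
  have h2 : Integrable fun ξ : ℝ => ξ ^ (n : ℝ) * Real.exp (-(1 / 2) * ξ ^ 2) :=
    integrable_rpow_mul_exp_neg_mul_sq (by norm_num)
      (lt_of_lt_of_le (by norm_num) (Nat.cast_nonneg n))
  refine (h1.add h2.norm).mono' (by fun_prop) (.of_forall fun ξ => ?_)
  simp only [Real.rpow_natCast, norm_mul, norm_pow, Real.norm_eq_abs, Real.abs_exp, Pi.add_apply]
  rw [abs_of_nonneg (show (0 : ℝ) ≤ max 1 |ξ| by positivity),
    (by ring : Real.exp (-(1 / 2) * ξ ^ 2) + |ξ| ^ n * Real.exp (-(1 / 2) * ξ ^ 2) =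
      (|ξ| ^ n + 1) * Real.exp (-(1 / 2) * ξ ^ 2))]
  refine mul_le_mul_of_nonneg_right ?_ (Real.exp_pos _).le
  rcases max_choice 1 |ξ| with h | h <;> rw [h]
  · rw [one_pow]
    linarith [pow_nonneg (abs_nonneg ξ) n]
  · linarith

lemma integrable_norm_pow_mul_heatDensity {g : ℝ → ℂ} (hm : AEStronglyMeasurable g) (n : ℕ)
    (hg : Integrable fun ω => |ω| ^ n * ‖g ω‖) :
    Integrable (fun v : ℝ × ℝ => ‖v‖ ^ n * ‖heatDensity g v‖) := by
  set w : ℝ → ℝ := fun ξ => max 1 |ξ| ^ n * Real.exp (-(1 / 2) * ξ ^ 2) with hw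
  have hwi : Integrable w := integrable_max_pow_mul_exp n
  have hmeas : AEStronglyMeasurable (fun v : ℝ × ℝ => ‖v‖ ^ n * ‖heatDensity g v‖)
      (volume.prod volume) :=
    (by fun_prop : Continuous fun v : ℝ × ℝ => ‖v‖ ^ n).aestronglyMeasurable.mul
      (aestronglyMeasurable_heatDensity hm).norm
  -- With η = ωξ the sup norm becomes |ω| max(1, |ξ|), so the planar moment factors into a moment of
  -- `g` and a Gaussian moment.
  have hslice : ∀ ω : ℝ, ω ≠ 0 → ∀ η : ℝ, ‖(ω, η)‖ ^ n * ‖heatDensity g (ω, η)‖ =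
      (|ω| ^ n * ‖g ω‖ * |ω|⁻¹ * (√(2 * Real.pi))⁻¹) * w (ω⁻¹ * η) := by
    intro ω hω η
    have hω' : 0 < |ω| := abs_pos.2 hω
    have h1 : ‖(ω, η)‖ = |ω| * max 1 |ω⁻¹ * η| := by
      rw [Prod.norm_mk, mul_max_of_nonneg _ _ hω'.le, mul_one, abs_mul, abs_inv,
        mul_inv_cancel_left₀ hω'.ne', Real.norm_eq_abs, Real.norm_eq_abs]
    have h2 : ‖heatDensity g (ω, η)‖ = ‖g ω‖ *
        (|ω|⁻¹ * Real.exp (-(1 / 2) * (ω⁻¹ * η) ^ 2) * (√(2 * Real.pi))⁻¹) := by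
      simp only [heatDensity]
      rw [norm_mul, Complex.norm_real, Real.norm_eq_abs, abs_of_nonneg (by positivity)]
    rw [h1, h2, mul_pow]
    simp only [hw]
    ring
  rw [Measure.volume_eq_prod, integrable_prod_iff hmeas]
  constructor
  · filter_upwards [ae_ne_zero_real] with ω hω
    simp_rw [hslice ω hω]
    exact ((hwi.comp_mul_left' (inv_ne_zero hω)).const_mul _)
  · refine (hg.mul_const ((√(2 * Real.pi))⁻¹ * ∫ ξ, w ξ)).congr ?_
    filter_upwards [ae_ne_zero_real] with ω hω
    have hω' : |ω| ≠ 0 := abs_ne_zero.2 hω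
    have h : ∀ η : ℝ, ‖‖(ω, η)‖ ^ n * ‖heatDensity g (ω, η)‖‖ =
        ‖(ω, η)‖ ^ n * ‖heatDensity g (ω, η)‖ := fun η =>
      Real.norm_of_nonneg (by positivity)
    simp_rw [h, hslice ω hω]
    rw [integral_const_mul, Measure.integral_comp_inv_mul_left, smul_eq_mul]
    field_simp

/-- The pairing of the frequency plane with the plane, normalised for the Fourier transform. -/
noncomputable def freqPairing : (ℝ × ℝ) →L[ℝ] (ℝ × ℝ) →L[ℝ] ℝ :=
  (-(2 * Real.pi)⁻¹) •
    ((ContinuousLinearMap.fst ℝ ℝ ℝ).smulRight (ContinuousLinearMap.fst ℝ ℝ ℝ) +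
      (ContinuousLinearMap.snd ℝ ℝ ℝ).smulRight (ContinuousLinearMap.snd ℝ ℝ ℝ))

lemma freqPairing_apply (v z : ℝ × ℝ) :
    freqPairing v z = -(2 * Real.pi)⁻¹ * (v.1 * z.1 + v.2 * z.2) := by
  simp [freqPairing]
  ring

lemma fourierChar_freqPairing (v z : ℝ × ℝ) :
    (Real.fourierChar (-freqPairing v z) : ℂ) =
      Complex.exp ((v.1 * z.1 + v.2 * z.2 : ℝ) * Complex.I) := by
  rw [Real.fourierChar_apply, freqPairing_apply]
  congr 2
  norm_cast
  field_simp

/-- Substituting η = ωξ reduces this to the Fourier transform of the standard Gaussian at ωσ. -/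
lemma integral_fourierChar_heatDensity {g : ℝ → ℂ} {ω : ℝ} (hω : ω ≠ 0) (z : ℝ × ℝ) :
    ∫ η : ℝ, Real.fourierChar (-freqPairing (ω, η) z) • heatDensity g (ω, η) =
      g ω * Complex.exp (heatPhase ω z) := by
  set u : ℝ → ℂ := fun ξ => Complex.exp (Complex.I * ((ω * z.2 : ℝ) : ℂ) * ξ) *
    Complex.exp (-(1 / 2 : ℂ) * ξ ^ 2) with hu
  set A : ℂ := g ω * Complex.exp ((ω * z.1 : ℝ) * Complex.I) *
    (((|ω|⁻¹ * (√(2 * Real.pi))⁻¹ : ℝ)) : ℂ) with hA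
  have h1 : ∀ η : ℝ, Real.fourierChar (-freqPairing (ω, η) z) • heatDensity g (ω, η) =
      A * u (ω⁻¹ * η) := by
    intro η
    rw [Circle.smul_def, fourierChar_freqPairing, smul_eq_mul]
    simp only [heatDensity, hu, hA]
    have e1 : Complex.I * ((ω * z.2 : ℝ) : ℂ) * ((ω⁻¹ * η : ℝ) : ℂ) =
        ((η * z.2 : ℝ) : ℂ) * Complex.I := by
      rw [mul_assoc, ← Complex.ofReal_mul, mul_comm]
      congr 2
      field_simp
    have e2 : ((ω * z.1 + η * z.2 : ℝ) : ℂ) * Complex.I =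
        (ω * z.1 : ℝ) * Complex.I + (η * z.2 : ℝ) * Complex.I := by
      push_cast
      ring
    rw [e1, e2, Complex.exp_add]
    push_cast
    ring
  simp_rw [h1]
  rw [integral_const_mul, Measure.integral_comp_inv_mul_left, fourierIntegral_gaussian
    (by norm_num : 0 < (1 / 2 : ℂ).re)]
  have e3 : ((Real.pi : ℂ) / (1 / 2)) ^ (1 / 2 : ℂ) = ((√(2 * Real.pi) : ℝ) : ℂ) := by
    rw [Real.sqrt_eq_rpow, Complex.ofReal_cpow (by positivity)]
    push_cast
    congr 1
    ring
  have e4 : heatPhase ω z = (ω * z.1 : ℝ) * Complex.I +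
      -((ω * z.2 : ℝ) : ℂ) ^ 2 / (4 * (1 / 2)) := by
    simp only [heatPhase]
    push_cast
    ring
  have hω' : ((|ω| : ℝ) : ℂ) ≠ 0 := Complex.ofReal_ne_zero.2 (abs_ne_zero.2 hω)
  have hs : ((√(2 * Real.pi) : ℝ) : ℂ) ≠ 0 := Complex.ofReal_ne_zero.2 (by positivity)
  rw [e3, e4, Complex.exp_add, hA, Complex.real_smul]
  push_cast
  field_simp

lemma heatTransform_eq_fourierIntegral {g : ℝ → ℂ} (hg : Integrable g) (z : ℝ × ℝ) :
    heatTransform g z = ∫ v, Real.fourierChar (-freqPairing v z) • heatDensity g v := by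
  have hi : Integrable (fun v => Real.fourierChar (-freqPairing v z) • heatDensity g v) := by
    have h0 := integrable_norm_pow_mul_heatDensity hg.1 0 (by simpa using hg.norm)
    simp only [pow_zero, one_mul] at h0
    have hm : AEStronglyMeasurable (heatDensity g) := aestronglyMeasurable_heatDensity hg.1
    refine h0.mono' ?_ (.of_forall fun v => by rw [Circle.norm_smul])
    have hc : Continuous fun v => Real.fourierChar (-freqPairing v z) :=
      Real.continuous_fourierChar.comp (by fun_prop)
    exact hc.aestronglyMeasurable.smul hm
  rw [Measure.volume_eq_prod] at hi ⊢
  rw [integral_prod _ hi]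
  refine integral_congr_ae ?_
  filter_upwards [ae_ne_zero_real] with ω hω
  rw [integral_fourierChar_heatDensity hω]

lemma contDiff_heatTransform {g : ℝ → ℂ} {r : ℕ∞} (hm : AEStronglyMeasurable g)
    (hg : ∀ n : ℕ, (n : ℕ∞) ≤ r → Integrable fun ω => |ω| ^ n * ‖g ω‖) :
    ContDiff ℝ r (heatTransform g) := by
  have hg0 : Integrable g := (integrable_norm_iff hm).1 (by simpa using hg 0 (by simp))
  have h := VectorFourier.contDiff_fourierIntegral freqPairing (f := heatDensity g)
    (μ := volume) (N := r) fun n hn => integrable_norm_pow_mul_heatDensity hm n (hg n hn)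
  have e : heatTransform g = VectorFourier.fourierIntegral Real.fourierChar volume
      freqPairing.toLinearMap₁₂ (heatDensity g) :=
    funext fun z => heatTransform_eq_fourierIntegral hg0 z
  rwa [e]

/-- A superposition of heat waves with integrable spectrum tends to zero at infinity. -/
lemma tendsto_heatTransform_cocompact {g : ℝ → ℂ} (hg : Integrable g) :
    Tendsto (heatTransform g) (cocompact (ℝ × ℝ)) (𝓝 0) := by
  have h := tendsto_integral_exp_smul_cocompact (heatDensity g) (volume : Measure (ℝ × ℝ))
  let L : (ℝ × ℝ) →ₗ[ℝ] StrongDual ℝ (ℝ × ℝ) := freqPairing.flip.toLinearMap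
  have hL : LinearMap.ker L = ⊥ := by
    rw [LinearMap.ker_eq_bot']
    intro z hz
    have h1 : freqPairing (1, 0) z = 0 := DFunLike.congr_fun hz (1, 0)
    have h2 : freqPairing (0, 1) z = 0 := DFunLike.congr_fun hz (0, 1)
    rw [freqPairing_apply] at h1 h2
    have hpi : -(2 * Real.pi)⁻¹ ≠ 0 := neg_ne_zero.2 (by positivity)
    have h3 := (mul_eq_zero.1 h1).resolve_left hpi
    have h4 := (mul_eq_zero.1 h2).resolve_left hpi
    ext
    · simpa using h3
    · simpa using h4
  -- An injective linear map into the dual is a closed embedding, so going to infinity in the plane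
  -- is going to infinity in the dual, where the Riemann–Lebesgue lemma applies.
  have h' := h.comp (LinearMap.isClosedEmbedding_of_injective hL).tendsto_cocompact
  refine h'.congr fun z => ?_
  rw [heatTransform_eq_fourierIntegral hg]
  rfl

/-! ### Gaussian moments and the kernels -/

/-- The weight `ω^q` on the positive half line, extended by zero. -/
noncomputable def powWeight (q ω : ℝ) : ℝ := Set.indicator (Set.Ioi 0) (fun ω => ω ^ q) ω

lemma powWeight_of_pos {q ω : ℝ} (h : 0 < ω) : powWeight q ω = ω ^ q :=
  Set.indicator_of_mem (Set.mem_Ioi.2 h) _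

lemma powWeight_of_nonpos {q ω : ℝ} (h : ω ≤ 0) : powWeight q ω = 0 :=
  Set.indicator_of_notMem (by simpa using h) _

lemma powWeight_nonneg (q ω : ℝ) : 0 ≤ powWeight q ω :=
  Set.indicator_nonneg (fun ω (h : 0 < ω) => Real.rpow_nonneg h.le q) ω

lemma measurable_powWeight (q : ℝ) : Measurable (powWeight q) :=
  (by fun_prop : Measurable fun ω : ℝ => ω ^ q).indicator measurableSet_Ioi

lemma powWeight_mul_pow (q ω : ℝ) (n : ℕ) : powWeight q ω * ω ^ n = powWeight (q + n) ω := by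
  rcases le_or_gt ω 0 with h | h
  · rw [powWeight_of_nonpos h, powWeight_of_nonpos h, zero_mul]
  · rw [powWeight_of_pos h, powWeight_of_pos h, Real.rpow_add_natCast h.ne']

lemma integrable_powWeight_mul_exp {q b : ℝ} (hq : -1 < q) (hb : 0 < b) :
    Integrable fun ω => powWeight q ω * Real.exp (-b * ω ^ 2) := by
  have h := (integrable_indicator_iff measurableSet_Ioi).2
    (integrableOn_rpow_mul_exp_neg_mul_sq hb hq)
  refine h.congr (.of_forall fun ω => ?_)
  rcases le_or_gt ω 0 with h | h
  · simp [powWeight_of_nonpos h, Set.indicator_of_notMem, h]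
  · simp [powWeight_of_pos h, Set.indicator_of_mem, h]

/-- The moment `∫₀^∞ ω^q exp(-ω²/2) dω`. -/
noncomputable def gaussMoment (q : ℝ) : ℝ := ∫ ω, powWeight q ω * Real.exp (-(1 / 2) * ω ^ 2)

lemma gaussMoment_eq {q : ℝ} (hq : -1 < q) :
    gaussMoment q = (1 / 2 : ℝ) ^ (-(q + 1) / 2) * (1 / 2) * Real.Gamma ((q + 1) / 2) := by
  rw [← integral_rpow_mul_exp_neg_mul_rpow two_pos hq (by norm_num : (0 : ℝ) < 1 / 2),
    ← integral_indicator measurableSet_Ioi]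
  refine integral_congr_ae (.of_forall fun ω => ?_)
  rcases le_or_gt ω 0 with h | h
  · simp [powWeight_of_nonpos h, Set.indicator_of_notMem, h]
  · simp [powWeight_of_pos h, Set.indicator_of_mem, h]

lemma gaussMoment_pos {q : ℝ} (hq : -1 < q) : 0 < gaussMoment q := by
  rw [gaussMoment_eq hq]
  have := Real.Gamma_pos_of_pos (show 0 < (q + 1) / 2 by linarith)
  positivity

lemma gaussMoment_add_two {q : ℝ} (hq : -1 < q) :
    gaussMoment (q + 2) = (q + 1) * gaussMoment q := by
  rw [gaussMoment_eq hq, gaussMoment_eq (by linarith),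
    show (q + 2 + 1) / 2 = (q + 1) / 2 + 1 by ring, Real.Gamma_add_one (by linarith),
    show -(q + 2 + 1) / 2 = -(q + 1) / 2 - 1 by ring, Real.rpow_sub_one (by norm_num)]
  ring

/-- The Gamma recursion produces exactly the products in the kernel series, which are therefore
quotients of moments. -/
lemma gaussMoment_add_two_mul {q : ℝ} (hq : -1 < q) (n : ℕ) :
    gaussMoment (q + (2 * n : ℕ)) =
      gaussMoment q * ∏ k ∈ Finset.range n, (q + 2 * (k : ℝ) + 1) := by
  induction n with
  | zero => simp
  | succ n ih =>
    have h : q + ((2 * (n + 1) : ℕ) : ℝ) = q + ((2 * n : ℕ) : ℝ) + 2 := by push_cast; ring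
    have h2 : (0 : ℝ) ≤ ((2 * n : ℕ) : ℝ) := Nat.cast_nonneg _
    rw [h, gaussMoment_add_two (by linarith), ih, Finset.prod_range_succ]
    push_cast
    ring

/-- Term by term integration of the exponential series against `ω^p exp(-ω²/2)`. -/
lemma hasSum_heatTransform_powWeight {p : ℝ} (hp : -1 < p) (z : ℝ) :
    HasSum (fun n : ℕ => (Complex.I * z) ^ n / (n ! : ℂ) * (gaussMoment (p + n) : ℂ))
      (heatTransform (fun ω => (powWeight p ω : ℂ)) (z, 1)) := by
  set G : ℝ → ℝ := fun ω => Real.exp (-(1 / 2) * ω ^ 2) with hG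
  set F : ℕ → ℝ → ℂ := fun n ω =>
    (powWeight p ω : ℂ) * ((Complex.I * z * ω) ^ n / (n ! : ℂ)) * (G ω : ℂ) with hF
  have hbs : ∀ ω, HasSum (fun n : ℕ => powWeight p ω * ((|z| * |ω|) ^ n / (n ! : ℝ)) * G ω)
      (powWeight p ω * Real.exp (|z| * |ω|) * G ω) := by
    intro ω
    have := NormedSpace.expSeries_div_hasSum_exp (𝔸 := ℝ) (|z| * |ω|)
    rw [← Real.exp_eq_exp_ℝ] at this
    exact (this.mul_left _).mul_right _
  have key := hasSum_integral_of_dominated_convergence (μ := volume) (F := F)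
    (f := fun ω => (powWeight p ω : ℂ) * Complex.exp (heatPhase ω (z, 1)))
    (fun n ω => powWeight p ω * ((|z| * |ω|) ^ n / (n ! : ℝ)) * G ω) ?_ ?_ ?_ ?_ ?_
  · have e : (fun n => ∫ ω, F n ω) = fun n : ℕ =>
        (Complex.I * z) ^ n / (n ! : ℂ) * (gaussMoment (p + n) : ℂ) := by
      funext n
      rw [gaussMoment, ← integral_complex_ofReal, ← integral_const_mul]
      refine integral_congr_ae (.of_forall fun ω => ?_)
      simp only [hF, hG, ← powWeight_mul_pow, mul_pow]
      push_cast
      ring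
    rw [e] at key
    exact key
  · intro n
    have h1 := (measurable_powWeight p)
    exact Measurable.aestronglyMeasurable (by fun_prop)
  · intro n
    refine .of_forall fun ω => le_of_eq ?_
    simp only [hF]
    rw [norm_mul, norm_mul, norm_div, norm_pow, norm_mul, norm_mul, Complex.norm_I, one_mul,
      Complex.norm_real, Complex.norm_real, Complex.norm_real, Complex.norm_real,
      Complex.norm_natCast, Real.norm_of_nonneg (powWeight_nonneg p ω),
      Real.norm_of_nonneg (Real.exp_pos _).le, Real.norm_eq_abs, Real.norm_eq_abs]
  · exact .of_forall fun ω => (hbs ω).summable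
  · have h4 := (integrable_powWeight_mul_exp hp (show (0 : ℝ) < 1 / 4 by norm_num)).const_mul
      (Real.exp (z ^ 2))
    simp_rw [fun ω => (hbs ω).tsum_eq]
    refine h4.mono' ?_ (.of_forall fun ω => ?_)
    · have h1 := (measurable_powWeight p)
      exact Measurable.aestronglyMeasurable (by fun_prop)
    · rw [Real.norm_of_nonneg (mul_nonneg (mul_nonneg (powWeight_nonneg p ω)
        (Real.exp_pos _).le) (Real.exp_pos _).le), mul_assoc,
        mul_left_comm (Real.exp (z ^ 2)), ← Real.exp_add, ← Real.exp_add]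
      -- From (|z| - |ω|/2)² ≥ 0: |z||ω| - ω²/2 ≤ z² - ω²/4.
      refine mul_le_mul_of_nonneg_left (Real.exp_le_exp.2 ?_) (powWeight_nonneg p ω)
      nlinarith [sq_nonneg (|z| - |ω| / 2), sq_abs z, sq_abs ω]
  · refine .of_forall fun ω => ?_
    have := NormedSpace.expSeries_div_hasSum_exp (𝔸 := ℂ) (Complex.I * z * ω)
    rw [← Complex.exp_eq_exp_ℂ] at this
    have h := (this.mul_left (powWeight p ω : ℂ)).mul_right (G ω : ℂ)
    have e : heatPhase ω (z, 1) = Complex.I * z * ω + ((-(1 / 2) * ω ^ 2 : ℝ) : ℂ) := by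
      simp only [heatPhase]
      push_cast
      ring
    rw [e, Complex.exp_add, ← Complex.ofReal_exp, ← mul_assoc]
    exact h

/-- Taking the real part of the moment series keeps the even powers of iz. -/
lemma kernelEven_eq {p : ℝ} (hp : -1 < p) (z : ℝ) :
    kernelEven p z = (√(2 * Real.pi))⁻¹ * (gaussMoment p)⁻¹ *
      (heatTransform (fun ω => (powWeight p ω : ℂ)) (z, 1)).re := by
  have h := Complex.hasSum_re (hasSum_heatTransform_powWeight hp z)
  have hinj : Function.Injective fun n : ℕ => 2 * n := fun a b h => by simpa using h
  rw [← hinj.hasSum_iff] at h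
  · have hm := (gaussMoment_pos hp).ne'
    have h' := h.mul_left (gaussMoment p)⁻¹
    rw [kernelEven, mul_assoc, one_div, ← h'.tsum_eq]
    congr 1
    refine tsum_congr fun n => ?_
    have e : (Complex.I * z) ^ (2 * n) / ((2 * n)! : ℂ) * (gaussMoment (p + (2 * n : ℕ)) : ℂ) =
        ((z ^ (2 * n) / ((2 * n)! : ℝ) * (-1) ^ n * gaussMoment (p + (2 * n : ℕ)) : ℝ) : ℂ) := by
      rw [mul_pow, pow_mul Complex.I, Complex.I_sq]
      push_cast
      ring
    simp only [Function.comp_apply]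
    rw [e, Complex.ofReal_re, gaussMoment_add_two_mul hp]
    field_simp
  · intro n hn
    have hodd : ¬ Even n := fun ⟨k, hk⟩ => hn ⟨k, by simp only; omega⟩
    obtain ⟨k, rfl⟩ := Nat.not_even_iff_odd.1 hodd
    have e : (Complex.I * z) ^ (2 * k + 1) / ((2 * k + 1)! : ℂ) *
        (gaussMoment (p + (2 * k + 1 : ℕ)) : ℂ) =
        ((z ^ (2 * k + 1) / ((2 * k + 1)! : ℝ) * (-1) ^ k *
          gaussMoment (p + (2 * k + 1 : ℕ)) : ℝ) : ℂ) * Complex.I := by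
      rw [mul_pow, pow_succ Complex.I, pow_mul Complex.I, Complex.I_sq]
      push_cast
      ring
    rw [e, Complex.re_ofReal_mul, Complex.I_re, mul_zero]

/-- The imaginary part keeps the odd powers. The factor p is split off the product so that the
normalising moment has order p + 1; the moment of order p - 1 would diverge at p = 0. -/
lemma kernelOdd_eq {p : ℝ} (hp : -1 < p) (z : ℝ) :
    kernelOdd p z = (√(2 * Real.pi))⁻¹ * (p * (gaussMoment (p + 1))⁻¹) *
      (heatTransform (fun ω => (powWeight p ω : ℂ)) (z, 1)).im := by
  have h := Complex.hasSum_im (hasSum_heatTransform_powWeight hp z)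
  have hinj : Function.Injective fun n : ℕ => 2 * n + 1 := fun a b h => by simpa using h
  rw [← hinj.hasSum_iff] at h
  · have hm := (gaussMoment_pos (show -1 < p + 1 by linarith)).ne'
    have h' := h.mul_left (p * (gaussMoment (p + 1))⁻¹)
    rw [kernelOdd, mul_assoc, one_div, ← h'.tsum_eq]
    congr 1
    refine tsum_congr fun n => ?_
    have e : (Complex.I * z) ^ (2 * n + 1) / ((2 * n + 1)! : ℂ) *
        (gaussMoment (p + (2 * n + 1 : ℕ)) : ℂ) =
        ((z ^ (2 * n + 1) / ((2 * n + 1)! : ℝ) * (-1) ^ n *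
          gaussMoment (p + (2 * n + 1 : ℕ)) : ℝ) : ℂ) * Complex.I := by
      rw [mul_pow, pow_succ Complex.I, pow_mul Complex.I, Complex.I_sq]
      push_cast
      ring
    have e2 : p + ((2 * n + 1 : ℕ) : ℝ) = p + 1 + ((2 * n : ℕ) : ℝ) := by push_cast; ring
    have e3 : ∏ k ∈ Finset.range n, (p + 1 + 2 * (k : ℝ) + 1) =
        ∏ k ∈ Finset.range n, (p + 2 * ((k + 1 : ℕ) : ℝ)) :=
      Finset.prod_congr rfl fun k _ => by push_cast; ring
    simp only [Function.comp_apply]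
    rw [e, Complex.im_ofReal_mul, Complex.I_im, mul_one, e2,
      gaussMoment_add_two_mul (by linarith), Finset.prod_range_succ', e3]
    field_simp
    simp
    ring
  · intro n hn
    have heven : ¬ Odd n := fun ⟨k, hk⟩ => hn ⟨k, by simp only; omega⟩
    obtain ⟨k, rfl⟩ := (Nat.not_odd_iff_even.1 heven).two_dvd
    have e : (Complex.I * z) ^ (2 * k) / ((2 * k)! : ℂ) * (gaussMoment (p + (2 * k : ℕ)) : ℂ) =
        ((z ^ (2 * k) / ((2 * k)! : ℝ) * (-1) ^ k * gaussMoment (p + (2 * k : ℕ)) : ℝ) : ℂ) := by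
      rw [mul_pow, pow_mul Complex.I, Complex.I_sq]
      push_cast
      ring
    rw [e, Complex.ofReal_im]

/-- The complex normalisation of the kernels. -/
noncomputable def kernelCoeff (θ : Parity) (p : ℝ) : ℂ :=
  match θ with
  | Parity.even => ((√(2 * Real.pi))⁻¹ * (gaussMoment p)⁻¹ : ℝ)
  | Parity.odd => ((√(2 * Real.pi))⁻¹ * (p * (gaussMoment (p + 1))⁻¹) : ℝ) * -Complex.I

lemma kernel_eq (θ : Parity) {p : ℝ} (hp : -1 < p) (z : ℝ) :
    kernel θ p z =
      (kernelCoeff θ p * heatTransform (fun ω => (powWeight p ω : ℂ)) (z, 1)).re := by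
  cases θ with
  | even => rw [kernel, kernelEven_eq hp, kernelCoeff, Complex.re_ofReal_mul]
  | odd =>
    rw [kernel, kernelOdd_eq hp, kernelCoeff, mul_assoc (Complex.ofReal _), Complex.re_ofReal_mul]
    simp

/-! ### The scale-space function as a heat superposition -/

/-- The Fourier transform `∫ f(y) exp(-iωy) dy` of a real signal. -/
noncomputable def signalFourier (f : ℝ → ℝ) (ω : ℝ) : ℂ :=
  𝓕 (fun y => (f y : ℂ)) (ω / (2 * Real.pi))

lemma signalFourier_eq (f : ℝ → ℝ) (ω : ℝ) :
    signalFourier f ω = ∫ y, (f y : ℂ) * Complex.exp (((-(ω * y) : ℝ) : ℂ) * Complex.I) := by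
  rw [signalFourier, Real.fourier_real_eq_integral_exp_smul]
  refine integral_congr_ae (.of_forall fun y => ?_)
  simp only [smul_eq_mul]
  rw [mul_comm, show -2 * Real.pi * y * (ω / (2 * Real.pi)) = -(ω * y) by field_simp]

/-- The spectrum of the scale-space function of `f`. -/
noncomputable def signalSpectrum (f : ℝ → ℝ) (θ : Parity) (p ω : ℝ) : ℂ :=
  kernelCoeff θ p * (powWeight p ω * signalFourier f ω)

/-- Substituting ρu for the frequency: the weight is homogeneous of degree p and the Jacobian
supplies one more power of ρ. -/
lemma rpow_mul_heatTransform_powWeight (p ν : ℝ) {ρ : ℝ} (hρ : 0 < ρ) :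
    ((ρ ^ (p + 1) : ℝ) : ℂ) * heatTransform (fun ω => (powWeight p ω : ℂ)) (ν * ρ, 1) =
      heatTransform (fun ω => (powWeight p ω : ℂ)) (ν, ρ⁻¹) := by
  set g : ℝ → ℂ := fun ω => (powWeight p ω : ℂ) * Complex.exp (heatPhase ω (ν, ρ⁻¹)) with hg
  have h := Measure.integral_comp_mul_left g ρ
  have h1 : ∀ u, g (ρ * u) = ((ρ ^ p : ℝ) : ℂ) *
      ((powWeight p u : ℂ) * Complex.exp (heatPhase u (ν * ρ, 1))) := by
    intro u
    have e1 : powWeight p (ρ * u) = ρ ^ p * powWeight p u := by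
      rcases le_or_gt u 0 with hu | hu
      · rw [powWeight_of_nonpos hu, powWeight_of_nonpos
          (mul_nonpos_of_nonneg_of_nonpos hρ.le hu), mul_zero]
      · rw [powWeight_of_pos hu, powWeight_of_pos (mul_pos hρ hu), Real.mul_rpow hρ.le hu.le]
    have e2 : heatPhase (ρ * u) (ν, ρ⁻¹) = heatPhase u (ν * ρ, 1) := by
      simp only [heatPhase]
      rw [show ρ * u * ν = u * (ν * ρ) by ring, show ρ * u * ρ⁻¹ = u * 1 by field_simp]
    simp only [hg, e1, e2]
    push_cast
    ring
  simp_rw [h1] at h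
  rw [integral_const_mul, Complex.real_smul, abs_of_pos (inv_pos.2 hρ)] at h
  have h2 : heatTransform (fun ω => (powWeight p ω : ℂ)) (ν, ρ⁻¹) = ∫ ω, g ω := rfl
  have h3 : heatTransform (fun ω => (powWeight p ω : ℂ)) (ν * ρ, 1) =
    ∫ u, (powWeight p u : ℂ) * Complex.exp (heatPhase u (ν * ρ, 1)) := rfl
  have hρ' : (ρ : ℂ) ≠ 0 := Complex.ofReal_ne_zero.2 hρ.ne'
  rw [h2, h3, Real.rpow_add_one hρ.ne', Complex.ofReal_mul, mul_right_comm, h]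
  push_cast
  field_simp

/-- Fubini: convolving a wave with `f` multiplies it by the Fourier transform of `f`. As ρ⁻¹ > 0,
the Gaussian factor makes the double integral absolutely convergent. -/
lemma phi_eq {f : ℝ → ℝ} (hf : Integrable f) (θ : Parity) {p : ℝ} (hp : -1 < p) (x : ℝ) {ρ : ℝ}
    (hρ : 0 < ρ) :
    phi f θ p x ρ = (heatTransform (signalSpectrum f θ p) (x, ρ⁻¹)).re := by
  set K : ℝ → ℝ → ℂ := fun ν ω =>
    (f (x - ν) : ℂ) * ((powWeight p ω : ℂ) * Complex.exp (heatPhase ω (ν, ρ⁻¹))) with hK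
  have hfx : Integrable fun ν => f (x - ν) := hf.comp_sub_left x
  have hKi : Integrable (Function.uncurry K) (volume.prod volume) := by
    have hb : Integrable (fun z : ℝ × ℝ => f (x - z.1) *
        (powWeight p z.2 * Real.exp (-(ρ⁻¹ ^ 2 / 2) * z.2 ^ 2))) (volume.prod volume) :=
      hfx.mul_prod (integrable_powWeight_mul_exp hp (by positivity))
    refine hb.norm.mono' ?_ (.of_forall fun z => le_of_eq ?_)
    · have h1 : AEStronglyMeasurable (fun z : ℝ × ℝ => (f (x - z.1) : ℂ))
          (volume.prod volume) := hfx.ofReal.1.comp_fst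
      have h2 := measurable_powWeight p
      have h3 : Measurable fun z : ℝ × ℝ => (powWeight p z.2 : ℂ) *
          Complex.exp (heatPhase z.2 (z.1, ρ⁻¹)) := by
        unfold heatPhase
        fun_prop
      exact h1.mul h3.aestronglyMeasurable
    · simp only [Function.uncurry, hK]
      rw [norm_mul, norm_mul, norm_mul, norm_mul, norm_exp_heatPhase, Complex.norm_real,
        Complex.norm_real, Real.norm_of_nonneg (Real.exp_pos _).le]
      congr 3
      ring
  have hinner : ∀ ω, ∫ ν, K ν ω =
      (powWeight p ω * signalFourier f ω) * Complex.exp (heatPhase ω (x, ρ⁻¹)) := by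
    intro ω
    rw [signalFourier_eq, ← integral_sub_left_eq_self _ volume x, ← integral_const_mul,
      ← integral_mul_const]
    refine integral_congr_ae (.of_forall fun ν => ?_)
    have e : heatPhase ω (x - ν, ρ⁻¹) =
        ((-(ω * ν) : ℝ) : ℂ) * Complex.I + heatPhase ω (x, ρ⁻¹) := by
      simp only [heatPhase]
      push_cast
      ring
    simp only [hK]
    rw [e, Complex.exp_add, sub_sub_cancel]
    ring
  have h1 : ∀ ν, f (x - ν) * (ρ ^ (p + 1) * kernel θ p (ν * ρ)) =
      (kernelCoeff θ p * ∫ ω, K ν ω).re := by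
    intro ν
    rw [kernel_eq θ hp, ← Complex.re_ofReal_mul, ← Complex.re_ofReal_mul, mul_left_comm
      ((ρ ^ (p + 1) : ℝ) : ℂ), rpow_mul_heatTransform_powWeight p ν hρ, mul_left_comm]
    simp only [hK]
    rw [integral_const_mul]
    rfl
  have hi : Integrable fun ν => kernelCoeff θ p * ∫ ω, K ν ω :=
    (hKi.integral_prod_left).const_mul _
  rw [phi]
  simp_rw [h1]
  have h2 : ∫ ν, (kernelCoeff θ p * ∫ ω, K ν ω).re = (∫ ν, kernelCoeff θ p * ∫ ω, K ν ω).re :=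
    integral_re hi
  rw [h2, integral_const_mul, integral_integral_swap hKi, ← integral_const_mul]
  simp_rw [hinner]
  congr 1
  refine integral_congr_ae (.of_forall fun ω => ?_)
  simp only [signalSpectrum]
  ring

lemma heatTransform_abs (g : ℝ → ℂ) (x σ : ℝ) :
    heatTransform g (x, |σ|) = heatTransform g (x, σ) := by
  simp only [heatTransform, heatPhase, mul_pow, sq_abs]

lemma heatTransform_neg (g : ℝ → ℂ) (x σ : ℝ) :
    heatTransform g (x, -σ) = heatTransform g (x, σ) := by
  rw [← heatTransform_abs, abs_neg, heatTransform_abs]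

/-- An integrable spectrum makes the superposition continuous up to σ = 0, so the limit ρ → ∞ is its
value there. -/
lemma Psi_eq {f : ℝ → ℝ} (hf : Integrable f) (θ : Parity) {p : ℝ} (hp : -1 < p)
    (hg : Integrable (signalSpectrum f θ p)) (x σ : ℝ) :
    Psi f θ p x σ = (heatTransform (signalSpectrum f θ p) (x, σ)).re := by
  rw [Psi]
  split_ifs with hσ
  · subst hσ
    have hcont : Continuous (heatTransform (signalSpectrum f θ p)) :=
      (contDiff_heatTransform (r := 0) hg.1 fun n hn => by
        have : n = 0 := by simpa using hn
        simpa [this] using hg.norm).continuous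
    have h1 : Tendsto (fun ρ : ℝ => (heatTransform (signalSpectrum f θ p) (x, ρ⁻¹)).re) atTop
        (𝓝 (heatTransform (signalSpectrum f θ p) (x, 0)).re) :=
      ((Complex.continuous_re.comp hcont).tendsto (x, 0)).comp
        (tendsto_const_nhds.prodMk_nhds tendsto_inv_atTop_zero)
    refine Tendsto.limUnder_eq (h1.congr' ?_)
    filter_upwards [eventually_gt_atTop 0] with ρ hρ
    rw [phi_eq hf θ hp x hρ]
  · rw [phi_eq hf θ hp x (by positivity), one_div, inv_inv, heatTransform_abs]

lemma continuous_signalFourier {f : ℝ → ℝ} (hf : Integrable f) :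
    Continuous (signalFourier f) := by
  have h : Continuous (𝓕 (fun y => (f y : ℂ))) :=
    VectorFourier.fourierIntegral_continuous Real.continuous_fourierChar
      (by fun_prop) hf.ofReal
  exact h.comp (by fun_prop)

lemma iteratedDeriv_ofReal_comp {f : ℝ → ℝ} {m : ℕ} (hf : ContDiff ℝ m f) {i : ℕ} (hi : i ≤ m) :
    iteratedDeriv i (fun y => (f y : ℂ)) = fun y => ((iteratedDeriv i f y : ℝ) : ℂ) := by
  induction i with
  | zero => simp
  | succ i ih =>
    rw [iteratedDeriv_succ, ih (by omega)]
    funext y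
    have hd : DifferentiableAt ℝ (iteratedDeriv i f) y :=
      hf.differentiable_iteratedDeriv i (by exact_mod_cast hi) y
    rw [iteratedDeriv_succ]
    exact hd.hasDerivAt.ofReal_comp.deriv

lemma IsSignal.exists_norm_signalFourier_le {f : ℝ → ℝ} {m : ℕ} (hf : IsSignal m f) {i : ℕ}
    (hi : i ≤ m) : ∃ C, ∀ ω, |ω| ^ i * ‖signalFourier f ω‖ ≤ C := by
  obtain ⟨hf1, hf2⟩ := hf
  refine ⟨∫ y, ‖iteratedDeriv i (fun y => (f y : ℂ)) y‖, fun ω => ?_⟩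
  have hcd : ContDiff ℝ ((m : ℕ∞) : WithTop ℕ∞) (fun y => (f y : ℂ)) :=
    Complex.ofRealCLM.contDiff.comp hf1
  have h := Real.fourier_iteratedDeriv (n := i) hcd (fun n hn => by
    have hn' : n ≤ m := by exact_mod_cast hn
    rw [iteratedDeriv_ofReal_comp hf1 hn']
    exact (hf2 n hn').ofReal) (by exact_mod_cast hi)
  have h' := congrFun h (ω / (2 * Real.pi))
  have hle : ‖𝓕 (iteratedDeriv i (fun y => (f y : ℂ))) (ω / (2 * Real.pi))‖ ≤
      ∫ y, ‖iteratedDeriv i (fun y => (f y : ℂ)) y‖ :=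
    VectorFourier.norm_fourierIntegral_le_integral_norm _ _ _ _ _
  rw [h', norm_smul, norm_pow] at hle
  have e : 2 * (Real.pi : ℂ) * Complex.I * ((ω / (2 * Real.pi) : ℝ) : ℂ) = Complex.I * ω := by
    have : (Real.pi : ℂ) ≠ 0 := Complex.ofReal_ne_zero.2 Real.pi_ne_zero
    push_cast
    field_simp
  rw [e, norm_mul, Complex.norm_I, one_mul, Complex.norm_real, Real.norm_eq_abs] at hle
  exact hle

lemma IsSignal.integrable {f : ℝ → ℝ} {m : ℕ} (hf : IsSignal m f) : Integrable f := by
  simpa using hf.2 0 (Nat.zero_le m)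

lemma IsSignal.aestronglyMeasurable_signalSpectrum {f : ℝ → ℝ} {m : ℕ} (hf : IsSignal m f)
    (θ : Parity) (p : ℝ) : AEStronglyMeasurable (signalSpectrum f θ p) := by
  have h1 := (continuous_signalFourier hf.integrable).measurable
  have h2 := measurable_powWeight p
  unfold signalSpectrum
  exact Measurable.aestronglyMeasurable (by fun_prop)

/-- For ω ≤ 1 the Fourier transform is bounded and p + n ≥ 0; for ω > 1 it is O(ω^(-m)), and p + n -
m < -1 is the assumption on `m`. -/
lemma IsSignal.integrable_pow_mul_signalSpectrum {f : ℝ → ℝ} {m : ℕ} (hf : IsSignal m f)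
    (θ : Parity) {p : ℝ} (hp : 0 ≤ p) {n : ℕ} (hm : p + n + 1 < m) :
    Integrable fun ω => |ω| ^ n * ‖signalSpectrum f θ p ω‖ := by
  obtain ⟨C₀, hC₀⟩ := hf.exists_norm_signalFourier_le (Nat.zero_le m)
  obtain ⟨C, hC⟩ := hf.exists_norm_signalFourier_le le_rfl
  have hC₀' : 0 ≤ C₀ := le_trans (by positivity) (hC₀ 0)
  have hC' : 0 ≤ C := le_trans (by positivity) (hC 0)
  have hb : Integrable fun ω : ℝ => ‖kernelCoeff θ p‖ *
      (Set.indicator (Set.Ioc 0 1) (fun _ => C₀) ω +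
        Set.indicator (Set.Ioi 1) (fun ω => ω ^ (p + n - m) * C) ω) := by
    refine Integrable.const_mul (Integrable.add ?_ ?_) _
    · exact (integrable_indicator_iff measurableSet_Ioc).2 (by simp)
    · exact (integrable_indicator_iff measurableSet_Ioi).2
        ((integrableOn_Ioi_rpow_of_lt (by linarith) one_pos).mul_const C)
  refine hb.mono' ?_ (.of_forall fun ω => ?_)
  · exact (by fun_prop : Continuous fun ω : ℝ => |ω| ^ n).aestronglyMeasurable.mul
      (hf.aestronglyMeasurable_signalSpectrum θ p).norm
  · have hF := hC ω
    have hF₀ := hC₀ ω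
    rw [pow_zero, one_mul] at hF₀
    have e : ‖|ω| ^ n * ‖signalSpectrum f θ p ω‖‖ =
        ‖kernelCoeff θ p‖ * (powWeight p ω * |ω| ^ n * ‖signalFourier f ω‖) := by
      rw [Real.norm_of_nonneg (by positivity), signalSpectrum, norm_mul, norm_mul,
        Complex.norm_real, Real.norm_of_nonneg (powWeight_nonneg p ω)]
      ring
    rw [e]
    refine mul_le_mul_of_nonneg_left ?_ (norm_nonneg _)
    rcases le_or_gt ω 0 with h0 | h0
    · rw [powWeight_of_nonpos h0, zero_mul, zero_mul]
      refine add_nonneg (Set.indicator_nonneg (fun _ _ => hC₀') _)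
        (Set.indicator_nonneg (fun ω hω => ?_) _)
      exact mul_nonneg (Real.rpow_nonneg (zero_le_one.trans (le_of_lt hω)) _) hC'
    · rw [abs_of_pos h0] at hF ⊢
      rw [powWeight_of_pos h0, ← Real.rpow_natCast ω n, ← Real.rpow_add h0]
      rcases le_or_gt ω 1 with h1 | h1
      · rw [Set.indicator_of_mem (show ω ∈ Set.Ioc 0 1 from ⟨h0, h1⟩),
          Set.indicator_of_notMem (by simpa using h1), add_zero]
        calc ω ^ (p + n) * ‖signalFourier f ω‖ ≤ 1 * C₀ :=
              mul_le_mul (Real.rpow_le_one h0.le h1 (by positivity)) hF₀ (norm_nonneg _) zero_le_one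
          _ = C₀ := one_mul _
      · rw [Set.indicator_of_notMem (fun h => absurd h.2 (not_le.2 h1)),
          Set.indicator_of_mem (Set.mem_Ioi.2 h1), zero_add]
        rw [show p + n = p + n - m + m by ring, Real.rpow_add h0, Real.rpow_natCast, mul_assoc,
          show p + n - m + m - m = p + n - (m : ℝ) by ring]
        exact mul_le_mul_of_nonneg_left hF (Real.rpow_nonneg h0.le _)

/-! ### Derivatives in x and compactness of the level set -/

lemma norm_iterate_spectralDeriv (g : ℝ → ℂ) (j : ℕ) (ω : ℝ) :
    ‖spectralDeriv^[j] g ω‖ = |ω| ^ j * ‖g ω‖ := by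
  induction j with
  | zero => simp
  | succ j ih =>
    rw [Function.iterate_succ_apply', spectralDeriv, norm_mul, norm_mul, Complex.norm_I, one_mul,
      Complex.norm_real, ih, Real.norm_eq_abs, pow_succ']
    ring

lemma aestronglyMeasurable_iterate_spectralDeriv {g : ℝ → ℂ} (hg : AEStronglyMeasurable g)
    (j : ℕ) : AEStronglyMeasurable (spectralDeriv^[j] g) := by
  induction j with
  | zero => exact hg
  | succ j ih =>
    rw [Function.iterate_succ_apply']
    exact AEStronglyMeasurable.mul (by fun_prop) ih

lemma integrable_iterate_spectralDeriv {g : ℝ → ℂ} (hm : AEStronglyMeasurable g) {j : ℕ}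
    (hg : Integrable fun ω => |ω| ^ j * ‖g ω‖) : Integrable (spectralDeriv^[j] g) := by
  rw [← integrable_norm_iff (aestronglyMeasurable_iterate_spectralDeriv hm j)]
  simpa only [norm_iterate_spectralDeriv] using hg

lemma hasDerivAt_re_heatTransform_fst {g : ℝ → ℂ} (hg : Integrable g)
    (hg' : Integrable (spectralDeriv g)) (x σ : ℝ) :
    HasDerivAt (fun y => (heatTransform g (y, σ)).re)
      (heatTransform (spectralDeriv g) (x, σ)).re x :=
  Complex.reCLM.hasFDerivAt.comp_hasDerivAt x (hasDerivAt_heatTransform_fst hg hg' x σ)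

lemma iteratedDeriv_re_heatTransform {g : ℝ → ℂ} (hm : AEStronglyMeasurable g) {j : ℕ}
    (hg : ∀ i ≤ j, Integrable fun ω => |ω| ^ i * ‖g ω‖) (σ : ℝ) :
    iteratedDeriv j (fun y => (heatTransform g (y, σ)).re) =
      fun x => (heatTransform (spectralDeriv^[j] g) (x, σ)).re := by
  induction j with
  | zero => simp
  | succ j ih =>
    rw [iteratedDeriv_succ, ih fun i hi => hg i (by omega)]
    funext x
    have h1 := integrable_iterate_spectralDeriv hm (hg j (by omega))
    have h2 := integrable_iterate_spectralDeriv hm (hg (j + 1) le_rfl)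
    rw [Function.iterate_succ_apply'] at h2 ⊢
    exact (hasDerivAt_re_heatTransform_fst h1 h2 x σ).deriv

/-- As c is not the limit 0, F avoids c outside some compact set. -/
lemma isCompact_levelSet_of_tendsto {F : ℝ × ℝ → ℝ} {c : ℝ} (hF : Continuous F)
    (hlim : Tendsto F (cocompact (ℝ × ℝ)) (𝓝 0)) (hc : c ≠ 0) : IsCompact {z | F z = c} := by
  have h := hlim.eventually (isOpen_ne.mem_nhds hc.symm)
  obtain ⟨t, ht, hsub⟩ := mem_cocompact.1 h
  refine ht.of_isClosed_subset (isClosed_eq hF continuous_const) fun z hz => ?_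
  by_contra hzt
  exact hsub hzt hz

lemma hasDerivAt_fst_of_differentiableAt {F : ℝ × ℝ → ℝ} {x σ : ℝ}
    (hF : DifferentiableAt ℝ F (x, σ)) :
    HasDerivAt (fun y => F (y, σ)) (fderiv ℝ F (x, σ) (1, 0)) x :=
  hF.hasFDerivAt.comp_hasDerivAt x ((hasDerivAt_id x).prodMk (hasDerivAt_const x σ))

lemma hasDerivAt_snd_of_differentiableAt {F : ℝ × ℝ → ℝ} {x σ : ℝ}
    (hF : DifferentiableAt ℝ F (x, σ)) :
    HasDerivAt (fun s => F (x, s)) (fderiv ℝ F (x, σ) (0, 1)) σ :=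
  hF.hasFDerivAt.comp_hasDerivAt σ ((hasDerivAt_const σ x).prodMk (hasDerivAt_id σ))

end ScaleSpace

/-! ### Proof of the theorem -/

open ScaleSpace in
theorem theorem3p1 (f : ℝ → ℝ) (θ : ScaleSpace.Parity) (p c : ℝ) (j : ℕ) (r : ℕ∞)
    (hp : 0 ≤ p) (hc : c ≠ 0) (hr : 1 ≤ r)
    (hf : ∀ k : ℕ, (k : ℕ∞) ≤ r →
      ∃ m : ℕ, p + 1 + (j : ℝ) + (k : ℝ) < (m : ℝ) ∧ ScaleSpace.IsSignal m f)
    (hgen : ScaleSpace.IsGeneric f θ p j c) :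
    ∃ (N : ℕ) (K : Fin N → Set (ℝ × ℝ)),
      ScaleSpace.levelSet f θ p j c = ⋃ i, K i ∧
      Pairwise (fun i i' => Disjoint (K i) (K i')) ∧
      ∀ i, ScaleSpace.IsClosedCurve r (K i) ∧ ScaleSpace.IsSymmetric (K i) := by
  set g := signalSpectrum f θ p with hg
  have hmom : ∀ k : ℕ, (k : ℕ∞) ≤ r → ∀ n ≤ j + k, Integrable fun ω => |ω| ^ n * ‖g ω‖ := by
    intro k hk n hn
    obtain ⟨m, hm, hs⟩ := hf k hk
    refine hs.integrable_pow_mul_signalSpectrum θ hp ?_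
    have : (n : ℝ) ≤ j + k := by exact_mod_cast hn
    linarith
  -- The order k = 1 gives moments up to j + 1, enough for `G` and its x-derivative to have
  -- integrable spectra.
  have hmom1 := hmom 1 (by exact_mod_cast hr)
  obtain ⟨m, -, hs⟩ := hf 1 (by exact_mod_cast hr)
  have hgm : AEStronglyMeasurable g := hs.aestronglyMeasurable_signalSpectrum θ p
  have hgi : Integrable g := by simpa using integrable_iterate_spectralDeriv hgm (hmom1 0 (by omega))
  have hPsi : ∀ σ, (fun y => Psi f θ p y σ) = fun y => (heatTransform g (y, σ)).re := fun σ =>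
    funext fun y => Psi_eq hs.integrable θ (by linarith) hgi y σ
  set G := spectralDeriv^[j] g with hG
  have hGi : Integrable G := integrable_iterate_spectralDeriv hgm (hmom1 j (by omega))
  have hGi' : Integrable (spectralDeriv G) := by
    have := integrable_iterate_spectralDeriv hgm (hmom1 (j + 1) le_rfl)
    rwa [Function.iterate_succ_apply'] at this
  set F : ℝ × ℝ → ℝ := fun z => (heatTransform G z).re with hF
  have hFsmooth : ContDiff ℝ r F := by
    refine Complex.reCLM.contDiff.comp (contDiff_heatTransform hGi.1 fun n hn => ?_)
    refine (hmom n hn (j + n) le_rfl).congr (.of_forall fun ω => ?_)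
    simp only [hG, norm_iterate_spectralDeriv, pow_add]
    ring
  have hF1 : ContDiff ℝ 1 F := hFsmooth.of_le (by exact_mod_cast hr)
  have hFd : Differentiable ℝ F := hF1.differentiable one_ne_zero
  have hmix0 : ∀ x σ, mixedPartial j 0 (Psi f θ p) x σ = F (x, σ) := by
    intro x σ
    simp only [mixedPartial, iteratedDeriv_zero]
    rw [hPsi, iteratedDeriv_re_heatTransform hgm fun i hi => hmom1 i (by omega)]
  have hmix1 : ∀ x σ, mixedPartial j 1 (Psi f θ p) x σ = fderiv ℝ F (x, σ) (0, 1) := by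
    intro x σ
    have h : (fun s => iteratedDeriv j (fun y => Psi f θ p y s) x) = fun s => F (x, s) :=
      funext fun s => by simpa [mixedPartial] using hmix0 x s
    rw [mixedPartial, iteratedDeriv_one, h]
    exact (hasDerivAt_snd_of_differentiableAt (hFd _)).deriv
  have hmix2 : ∀ x σ, mixedPartial (j + 1) 0 (Psi f θ p) x σ = fderiv ℝ F (x, σ) (1, 0) := by
    intro x σ
    have h : iteratedDeriv j (fun y => Psi f θ p y σ) = fun y => F (y, σ) :=
      funext fun y => by simpa [mixedPartial] using hmix0 y σ
    simp only [mixedPartial, iteratedDeriv_zero]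
    rw [iteratedDeriv_succ, h]
    exact (hasDerivAt_fst_of_differentiableAt (hFd _)).deriv
  have hlevel : levelSet f θ p j c = {z | F z = c} := by
    ext z
    simp only [levelSet, Set.mem_ofPred_eq, hmix0]
  have hreg : IsRegularLevel F c := by
    rintro ⟨x, σ⟩ hz h0
    exact hgen ⟨x, σ, by rw [hmix1, h0]; rfl, by rw [hmix2, h0]; rfl, by rw [hmix0, hz]⟩
  have hlim : Tendsto F (cocompact (ℝ × ℝ)) (𝓝 0) := by
    have := (Complex.continuous_re.tendsto 0).comp (tendsto_heatTransform_cocompact hGi)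
    rwa [Complex.zero_re] at this
  have hK := isCompact_levelSet_of_tendsto hFsmooth.continuous hlim hc
  rw [hlevel]
  -- Along a trajectory the derivative of P is (F - c)x' + σF_xσ'; the first term vanishes on the
  -- level and σ' = F_x.
  refine exists_symmetric_closedCurves (P := fun z => (heatPotential G z).re - c * z.1) hr
    hFsmooth hreg hK (fun x σ => by simp only [hF, heatTransform_neg]) ?_
  intro γ hγ t
  have hd : ∀ s, HasDerivAt γ (hamiltonianField F (γ s)) s := fun s => (hγ s (Set.mem_univ s)).1
  have hγc : Continuous γ := continuous_iff_continuousAt.2 fun s => (hd s).continuousAt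
  have h1 := Complex.reCLM.hasFDerivAt.comp_hasDerivAt t
    (hasDerivAt_heatPotential_comp hGi hGi' hd ((continuous_hamiltonianField hF1).comp hγc) t)
  have h2 : HasDerivAt (fun s => (γ s).1) (hamiltonianField F (γ t)).1 t :=
    (ContinuousLinearMap.fst ℝ ℝ ℝ).hasFDerivAt.comp_hasDerivAt t (hd t)
  have hx : (heatTransform (spectralDeriv G) (γ t)).re = (hamiltonianField F (γ t)).2 :=
    (hasDerivAt_re_heatTransform_fst hGi hGi' (γ t).1 (γ t).2).unique
      (hasDerivAt_fst_of_differentiableAt (hFd _))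
  have hFc : (heatTransform G (γ t)).re = c := (hγ t (Set.mem_univ t)).2
  refine (h1.sub (h2.const_mul c)).congr_deriv ?_
  simp only [Complex.reCLM_apply, Complex.add_re, Complex.re_mul_ofReal, hx, hFc]
  ring
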